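/- All graphs are finite and simple. A graph is called Eulerian if it is connected and every vertex has even degree. Let $G$ be an Eulerian graph on $n$ vertices with adjacency matrix $A$, let $e$ be the all-one column vector of length $n$, and let $W=[e,Ae,\ldots,A^{n-1}e]$ be the walk matrix of $G$. Then $2^{\lfloor (3n-3)/2\rfloor}$ divides $\det W$. Moreover, if the integer $2^{-\lfloor (3n-3)/2\rfloor}\det W$ is odd and square-free, then $G$ is determined by its generalized spectrum among all Eulerian graphs: every Eulerian graph $H$ on $n$ vertices such that the adjacency matrices of $G$ and $H$ have the same spectrum, and the adjacency matrices of the complements of $G$ and $H$ have the same spectrum (eigenvalues counted with multiplicity), is isomorphic to $G$. -/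

import Mathlib

namespace EulerianDGS

/-- The walk matrix `W(G) = [e, Ae, …, A^{n-1}e]` of a graph `G` on `n` vertices: its column
with index `j` (starting from `0`) is `A ^ j *ᵥ e`, where `A` is the adjacency matrix and `e` is
the all-one vector. -/
noncomputable def walkMatrix {n : ℕ} (G : SimpleGraph (Fin n)) : Matrix (Fin n) (Fin n) ℤ :=
  open Classical in
  Matrix.of fun i j => ((G.adjMatrix ℤ) ^ (j : ℕ)).mulVec 1 i

/-- A finite graph is Eulerian if it is connected and the degree of every vertex is even. -/
def IsEulerianGraph {n : ℕ} (G : SimpleGraph (Fin n)) : Prop :=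
  open Classical in
  G.Connected ∧ ∀ v, Even (G.degree v)

/-- The spectrum of a graph: the multiset of the eigenvalues of its adjacency matrix, with their
multiplicities as roots of the characteristic polynomial `det (x I - A)`. -/
noncomputable def spec {n : ℕ} (G : SimpleGraph (Fin n)) : Multiset ℂ :=
  open Classical in
  (G.adjMatrix ℂ).charpoly.roots

/-- Two graphs are generalized cospectral if they are cospectral with cospectral complements. -/
def GeneralizedCospectral {n : ℕ} (G H : SimpleGraph (Fin n)) : Prop :=
  spec G = spec H ∧ spec Gᶜ = spec Hᶜ

/-- `G` is determined by its generalized spectrum among all Eulerian graphs: every Eulerian graph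
on `n` vertices that is generalized cospectral with `G` is isomorphic to `G`. -/
def IsDGSAmongEulerian {n : ℕ} (G : SimpleGraph (Fin n)) : Prop :=
  ∀ H : SimpleGraph (Fin n), IsEulerianGraph H → GeneralizedCospectral G H → Nonempty (H ≃g G)

end EulerianDGS

/-! Write `Ae = 2f`, with `e` the all-one vector.

Modulo 2, `A` is alternating and kills `e`, and its characteristic polynomial is `X^(n % 2) * h^2`.
The core fact (`aeval_sqrt_charpoly_mulVec_eq_zero`) is that `h(A)` kills every vector orthogonal to
`e`. Hence `h(A)f ≡ ε e` mod 2 with an explicit integer `ε`, and `(hX - 2ε)(A)e = 2(h(A)f - εe)` is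
divisible by 4. In the monic basis `1, X, …, X^⌊n/2⌋, hX - 2ε, X(hX - 2ε), …` the walk matrix
therefore becomes `U D`, with `D` diagonal of determinant `2^⌊(3n-3)/2⌋`.

For rigidity, equal generalized spectra give equal characteristic polynomials and equal moments
`eᵀA^k e`. Since `ε` depends only on these data and the choice of `h`, the same base change and the
same `D` serve both graphs, so the powers of 2 cancel in `Q = W' W⁻¹ = U' U⁻¹`. The only remaining
denominators divide `q = det U`. An odd prime `p ∣ q` divides both walk determinants exactly once,
which forces the minimal polynomials of `e` mod `p` for the two graphs to coincide
(`dvd_krylov_mul_adjugate`); this removes `p` from the denominator. Thus `Q` is integral. Equal Gram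
matrices make it orthogonal, and it fixes `e` and intertwines the adjacency matrices, so it is a
permutation matrix giving an isomorphism. -/

namespace EulerianDGS

open Polynomial Matrix

/-! ### Krylov matrices and polynomial changes of basis. -/

section Krylov

variable {R : Type*} [CommRing R] {n : ℕ}

/-- The Krylov matrix `[v, Av, …, A^{n-1}v]`. -/
def krylov (A : Matrix (Fin n) (Fin n) R) (v : Fin n → R) : Matrix (Fin n) (Fin n) R :=
  Matrix.of fun i j => ((A ^ (j : ℕ)) *ᵥ v) i

/-- The matrix with columns `p_j(A) v`. -/
noncomputable def polyKrylov (A : Matrix (Fin n) (Fin n) R) (v : Fin n → R) (p : Fin n → R[X]) :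
    Matrix (Fin n) (Fin n) R :=
  Matrix.of fun i j => (aeval A (p j) *ᵥ v) i

/-- The matrix whose columns are the coefficient vectors of a family of polynomials. -/
noncomputable def coeffMatrix (p : Fin n → R[X]) : Matrix (Fin n) (Fin n) R :=
  Matrix.of fun i j => (p j).coeff i

theorem aeval_mulVec_eq_sum (A : Matrix (Fin n) (Fin n) R) (v : Fin n → R) {p : R[X]} {m : ℕ}
    (hp : p.natDegree < m) :
    aeval A p *ᵥ v = ∑ k ∈ Finset.range m, p.coeff k • (A ^ k *ᵥ v) := by
  rw [aeval_eq_sum_range' hp, Matrix.sum_mulVec]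
  simp [Matrix.smul_mulVec]

theorem krylov_mulVec (A : Matrix (Fin n) (Fin n) R) (v c : Fin n → R) :
    krylov A v *ᵥ c = ∑ k : Fin n, c k • (A ^ (k : ℕ) *ᵥ v) := by
  ext i
  simp [krylov, Matrix.mulVec, dotProduct, Finset.sum_apply, mul_comm]

theorem krylov_mulVec_coeff (A : Matrix (Fin n) (Fin n) R) (v : Fin n → R) {p : R[X]}
    (hp : p.natDegree < n) :
    krylov A v *ᵥ (fun k => p.coeff k) = aeval A p *ᵥ v := by
  rw [krylov_mulVec, aeval_mulVec_eq_sum A v hp, Finset.sum_range]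

theorem polyKrylov_eq (A : Matrix (Fin n) (Fin n) R) (v : Fin n → R) {p : Fin n → R[X]}
    (hp : ∀ j, (p j).natDegree ≤ j) :
    polyKrylov A v p = krylov A v * coeffMatrix p := by
  ext i j
  have := congrFun (krylov_mulVec_coeff A v ((hp j).trans_lt j.2)) i
  simp only [polyKrylov, of_apply, ← this]
  rfl

theorem det_coeffMatrix {p : Fin n → R[X]} (hp : ∀ j, (p j).natDegree ≤ j) :
    (coeffMatrix p).det = ∏ j, (p j).coeff j := by
  rw [Matrix.det_of_isUpperTriangular]
  · rfl
  · intro i j hij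
    exact coeff_eq_zero_of_natDegree_lt ((hp j).trans_lt hij)

theorem det_polyKrylov (A : Matrix (Fin n) (Fin n) R) (v : Fin n → R) {p : Fin n → R[X]}
    (hp : ∀ j, (p j).natDegree ≤ j) :
    (polyKrylov A v p).det = (krylov A v).det * ∏ j, (p j).coeff j := by
  rw [polyKrylov_eq A v hp, det_mul, det_coeffMatrix hp]

theorem map_comp_mulVec {S : Type*} [CommRing S] (φ : R →+* S) (A : Matrix (Fin n) (Fin n) R)
    (v : Fin n → R) : φ ∘ (A *ᵥ v) = A.map φ *ᵥ (φ ∘ v) :=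
  funext fun i => RingHom.map_mulVec φ A v i

theorem map_comp_pow_mulVec {S : Type*} [CommRing S] (φ : R →+* S) (A : Matrix (Fin n) (Fin n) R)
    (v : Fin n → R) (k : ℕ) : φ ∘ (A ^ k *ᵥ v) = (A.map φ) ^ k *ᵥ (φ ∘ v) := by
  have : (A.map φ) ^ k = (A ^ k).map φ := (map_pow φ.mapMatrix A k).symm
  rw [map_comp_mulVec, this]

theorem krylov_map {S : Type*} [CommRing S] (φ : R →+* S) (A : Matrix (Fin n) (Fin n) R)
    (v : Fin n → R) : (krylov A v).map φ = krylov (A.map φ) (φ ∘ v) := by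
  ext i j
  have : (A.map φ) ^ (j : ℕ) = (A ^ (j : ℕ)).map φ := (map_pow φ.mapMatrix A j).symm
  simp [krylov, this, RingHom.map_mulVec]

theorem map_aeval_mulVec {S : Type*} [CommRing S] (φ : R →+* S) (A : Matrix (Fin n) (Fin n) R)
    (v : Fin n → R) (p : R[X]) :
    φ ∘ (aeval A p *ᵥ v) = aeval (A.map φ) (p.map φ) *ᵥ (φ ∘ v) := by
  have h := aeval_mulVec_eq_sum (A.map φ) (φ ∘ v)
    (natDegree_map_le.trans_lt (Nat.lt_succ_self _) : (p.map φ).natDegree < p.natDegree + 1)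
  rw [h, aeval_mulVec_eq_sum A v (Nat.lt_succ_self _)]
  ext i
  have (k : ℕ) : (A.map φ) ^ k = (A ^ k).map φ := (map_pow φ.mapMatrix A k).symm
  simp [Finset.sum_apply, this, RingHom.map_mulVec]

theorem IsSymm.aeval {A : Matrix (Fin n) (Fin n) R} (hA : A.IsSymm) (p : R[X]) :
    (aeval A p).IsSymm := by
  rw [aeval_eq_sum_range]
  unfold Matrix.IsSymm
  simp [transpose_sum, transpose_smul, transpose_pow, hA.eq]

theorem dotProduct_mulVec_comm {A : Matrix (Fin n) (Fin n) R} (hA : A.IsSymm) (x y : Fin n → R) :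
    x ⬝ᵥ A *ᵥ y = A *ᵥ x ⬝ᵥ y := by
  rw [dotProduct_mulVec, ← mulVec_transpose, hA.eq]

end Krylov

/-! ### Determinants of low-rank updates. -/

section RankUpdate

/-- The matrix determinant lemma over the fraction field, with denominators cleared. -/
theorem det_rank_update {R : Type*} [CommRing R] [IsDomain R] {m k : Type*} [Fintype m]
    [DecidableEq m] [Fintype k] [DecidableEq k] (M : Matrix m m R) (hM : M.det ≠ 0)
    (U : Matrix m k R) (V : Matrix k m R) :
    M.det ^ Fintype.card k * (M + U * V).det =
      M.det * (M.det • (1 : Matrix k k R) + V * M.adjugate * U).det := by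
  set φ := algebraMap R (FractionRing R)
  have hinj : Function.Injective φ := IsFractionRing.injective R (FractionRing R)
  apply hinj
  have h0 : φ M.det ≠ 0 := by simpa using hinj.ne hM
  have hdet : (M.map φ).det = φ M.det := (RingHom.map_det φ M).symm
  have hunit : IsUnit (M.map φ).det := by rw [hdet]; exact h0.isUnit
  have key := det_add_mul (U.map φ) (V.map φ) hunit
  have h1 : φ (M + U * V).det = (M.map φ + U.map φ * V.map φ).det := by
    rw [RingHom.map_det, RingHom.mapMatrix_apply, Matrix.map_add _ (map_add φ), Matrix.map_mul]
  have h2 : φ (M.det • (1 : Matrix k k R) + V * M.adjugate * U).det =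
      (φ M.det • (1 : Matrix k k (FractionRing R)) +
        V.map φ * (M.map φ).adjugate * U.map φ).det := by
    rw [RingHom.map_det, RingHom.mapMatrix_apply, Matrix.map_add _ (map_add φ), Matrix.map_mul,
      Matrix.map_mul]
    congr 2
    · ext i j; simp [Matrix.one_apply, apply_ite φ]
    · congr 2
      exact RingHom.map_adjugate φ M
  rw [map_mul, map_mul, map_pow, h1, h2, key, hdet, mul_left_comm, ← det_smul, smul_add]
  congr 3
  rw [Matrix.inv_def, hdet, Matrix.mul_smul, Matrix.smul_mul, smul_smul,
    Ring.mul_inverse_cancel _ h0.isUnit, one_smul]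

theorem det_add_vecMulVec {R : Type*} [CommRing R] [IsDomain R] {m : Type*} [Fintype m]
    [DecidableEq m] (M : Matrix m m R) (hM : M.det ≠ 0) (u v : m → R) :
    (M + vecMulVec u v).det = M.det + v ⬝ᵥ M.adjugate *ᵥ u := by
  have h := det_rank_update M hM (replicateCol Unit u) (replicateRow Unit v)
  simp only [Fintype.card_unit, pow_one] at h
  have h := mul_left_cancel₀ hM h
  rw [← vecMulVec_eq, det_unique (_ • (1 : Matrix Unit Unit R) + _)] at h
  rw [h]
  simp [Matrix.mul_apply, dotProduct, mulVec, replicateRow, replicateCol, Finset.sum_mul,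
    Finset.mul_sum, mul_assoc]
  exact Finset.sum_comm

/-- Take the rank-two update by `y, z`: expanding the 2 × 2 determinant leaves this minor as the
only term without a visible factor `M.det`. -/
theorem det_dvd_adjugate_gram {R : Type*} [CommRing R] [IsDomain R] {m : Type*} [Fintype m]
    [DecidableEq m] (M : Matrix m m R) (hM : M.det ≠ 0) (y z : m → R) :
    M.det ∣ (y ⬝ᵥ M.adjugate *ᵥ y) * (z ⬝ᵥ M.adjugate *ᵥ z) -
      (y ⬝ᵥ M.adjugate *ᵥ z) * (z ⬝ᵥ M.adjugate *ᵥ y) := by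
  have h := det_rank_update M hM (Matrix.of fun i (j : Fin 2) => ![y, z] j i)
    (Matrix.of fun (j : Fin 2) i => ![y, z] j i)
  have hent (a b : Fin 2) : ((Matrix.of fun (j : Fin 2) i => ![y, z] j i) * M.adjugate *
      (Matrix.of fun i (j : Fin 2) => ![y, z] j i)) a b =
      (![y, z] a) ⬝ᵥ M.adjugate *ᵥ (![y, z] b) := by
    simp only [Matrix.mul_apply, dotProduct, mulVec, of_apply, Finset.sum_mul, Finset.mul_sum,
      mul_assoc]
    exact Finset.sum_comm
  rw [Fintype.card_fin, sq, mul_assoc] at h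
  have h := mul_left_cancel₀ hM h
  rw [det_fin_two] at h
  simp only [Matrix.add_apply, hent, Matrix.smul_apply, smul_eq_mul, Matrix.one_apply] at h
  simp only [Fin.isValue, ↓reduceIte, mul_one, cons_val_zero, cons_val_one, zero_ne_one,
    mul_zero, zero_add, one_ne_zero] at h
  refine ⟨(M + (Matrix.of fun i (j : Fin 2) => ![y, z] j i) *
    (Matrix.of fun (j : Fin 2) i => ![y, z] j i)).det - M.det - y ⬝ᵥ M.adjugate *ᵥ y -
      z ⬝ᵥ M.adjugate *ᵥ z, ?_⟩
  linear_combination -h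

end RankUpdate

/-! ### The generalized spectrum determines the walk counts. -/

section Moments

variable {R : Type*} [CommRing R] {n : ℕ}

/-- The polynomial `vᵀ A^k adj(x I - A) v`. -/
noncomputable def resolventMoment (A : Matrix (Fin n) (Fin n) R) (v : Fin n → R) (k : ℕ) : R[X] :=
  (C ∘ v) ⬝ᵥ ((A.map C) ^ k * (charmatrix A).adjugate) *ᵥ (C ∘ v)

theorem dotProduct_map_pow_mulVec (A : Matrix (Fin n) (Fin n) R) (v w : Fin n → R) (k : ℕ) :
    (C ∘ v) ⬝ᵥ (A.map C) ^ k *ᵥ (C ∘ w) = C (v ⬝ᵥ A ^ k *ᵥ w) := by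
  have : (A.map C) ^ k = (A ^ k).map C := (map_pow (C : R →+* R[X]).mapMatrix A k).symm
  rw [RingHom.map_dotProduct, this]
  congr 1
  ext1 i
  simp [RingHom.map_mulVec]

/-- Multiply `(xI - A) adj(xI - A) = φ I` by `A^k`. This recursion lets all moments be extracted one
after another. -/
theorem X_mul_resolventMoment (A : Matrix (Fin n) (Fin n) R) (v : Fin n → R) (k : ℕ) :
    X * resolventMoment A v k =
      resolventMoment A v (k + 1) + A.charpoly * C (v ⬝ᵥ A ^ k *ᵥ v) := by
  set A' := A.map (C : R →+* R[X]) with hA'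
  have h1 : charmatrix A * (charmatrix A).adjugate =
      A.charpoly • (1 : Matrix (Fin n) (Fin n) R[X]) :=
    mul_adjugate _
  have h2 : charmatrix A = (X : R[X]) • (1 : Matrix (Fin n) (Fin n) R[X]) - A' := by
    rw [charmatrix, scalar_apply, ← smul_one_eq_diagonal]; rfl
  have h3 : (X : R[X]) • (A' ^ k * (charmatrix A).adjugate) =
      A' ^ (k + 1) * (charmatrix A).adjugate + A.charpoly • A' ^ k := by
    have h4 : A' ^ k * (charmatrix A * (charmatrix A).adjugate) =
      A.charpoly • A' ^ k := by rw [h1, Matrix.mul_smul, Matrix.mul_one]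
    have h5 : A' ^ k * (charmatrix A * (charmatrix A).adjugate) =
      A' ^ k *
        (((X : R[X]) • (1 : Matrix (Fin n) (Fin n) R[X]) - A') * (charmatrix A).adjugate) := by
      rw [← h2]
    rw [← h4, h5, pow_succ, Matrix.sub_mul, Matrix.mul_sub, Matrix.smul_mul, Matrix.one_mul,
      Matrix.mul_smul, Matrix.mul_assoc]
    abel
  rw [← dotProduct_map_pow_mulVec, resolventMoment, resolventMoment, ← smul_eq_mul,
    ← dotProduct_smul, ← smul_mulVec, h3, add_mulVec, dotProduct_add, smul_mulVec,
    dotProduct_smul, smul_eq_mul]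

theorem exists_natDegree_resolventMoment_le (A : Matrix (Fin n) (Fin n) R) (v : Fin n → R) :
    ∃ D : ℕ, ∀ k, (resolventMoment A v k).natDegree ≤ D := by
  refine ⟨Finset.univ.sup fun i => Finset.univ.sup fun j =>
    ((charmatrix A).adjugate i j).natDegree, fun k => ?_⟩
  have hk : (A.map C) ^ k = (A ^ k).map (C : R →+* R[X]) :=
    (map_pow (C : R →+* R[X]).mapMatrix A k).symm
  rw [resolventMoment, hk, ← mulVec_mulVec, dotProduct_mulVec]
  simp only [dotProduct, mulVec, vecMul]
  refine natDegree_sum_le_of_forall_le _ _ fun i _ => ?_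
  have : (∑ j, (C ∘ v) j * (A ^ k).map (C : R →+* R[X]) j i) = C (∑ j, v j * (A ^ k) j i) := by
    simp
  rw [this]
  refine (natDegree_C_mul_le _ _).trans (natDegree_sum_le_of_forall_le _ _ fun j _ => ?_)
  refine (natDegree_mul_C_le _ _).trans ?_
  exact (Finset.le_sup (f := fun j => ((charmatrix A).adjugate i j).natDegree)
    (Finset.mem_univ j)).trans (Finset.le_sup (f := fun i => Finset.univ.sup fun j =>
    ((charmatrix A).adjugate i j).natDegree) (Finset.mem_univ i))

/-- Above the degree of the characteristic polynomial, the recursion moves coefficient `j` at `k` to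
coefficient `j + 1` at `k + 1`. Iterating passes any degree bound uniform in `k`. -/
theorem coeff_resolventMoment_of_le [Nontrivial R] (A : Matrix (Fin n) (Fin n) R) (v : Fin n → R)
    (k j : ℕ) (hj : n ≤ j) : (resolventMoment A v k).coeff j = 0 := by
  obtain ⟨D, hD⟩ := exists_natDegree_resolventMoment_le A v
  have hshift (t : ℕ) : (resolventMoment A v k).coeff j =
      (resolventMoment A v (k + t)).coeff (j + t) := by
    induction t with
    | zero => rfl
    | succ t ih =>
      have h := congrArg (fun p => p.coeff (j + t + 1)) (X_mul_resolventMoment A v (k + t))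
      have h0 : A.charpoly.coeff (j + t + 1) = 0 := by
        apply coeff_eq_zero_of_natDegree_lt
        rw [charpoly_natDegree_eq_dim, Fintype.card_fin]; omega
      simp only [coeff_X_mul, coeff_add, coeff_mul_C, h0, zero_mul, add_zero] at h
      rw [ih, h]; rfl
  rw [hshift (D + 1)]
  apply coeff_eq_zero_of_natDegree_lt
  have := hD (k + (D + 1))
  omega

theorem moment_eq_coeff [Nontrivial R] (hn : n ≠ 0) (A : Matrix (Fin n) (Fin n) R) (v : Fin n → R)
    (k : ℕ) : v ⬝ᵥ A ^ k *ᵥ v = (resolventMoment A v k).coeff (n - 1) := by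
  obtain ⟨m, rfl⟩ := Nat.exists_eq_succ_of_ne_zero hn
  have h := congrArg (fun p => p.coeff (m + 1)) (X_mul_resolventMoment A v k)
  have hl : A.charpoly.coeff (m + 1) = 1 := by
    have := A.charpoly_monic.coeff_natDegree
    rwa [charpoly_natDegree_eq_dim, Fintype.card_fin] at this
  simp only [coeff_X_mul, coeff_add, coeff_mul_C, hl, one_mul,
    coeff_resolventMoment_of_le A v (k + 1) (m + 1) le_rfl, zero_add] at h
  simpa using h.symm

/-- The moments `vᵀ A^k v` are determined by the characteristic polynomial of `A` and the
polynomial `vᵀ adj(x I - A) v`. -/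
theorem moment_eq_of_resolventMoment_eq [Nontrivial R] {A A' : Matrix (Fin n) (Fin n) R}
    {v : Fin n → R} (hφ : A.charpoly = A'.charpoly)
    (h0 : resolventMoment A v 0 = resolventMoment A' v 0) (k : ℕ) :
    v ⬝ᵥ A ^ k *ᵥ v = v ⬝ᵥ A' ^ k *ᵥ v := by
  rcases eq_or_ne n 0 with rfl | hn
  · simp [dotProduct]
  have key (k : ℕ) : resolventMoment A v k = resolventMoment A' v k := by
    induction k with
    | zero => exact h0
    | succ k ih =>
      have h1 := X_mul_resolventMoment A v k
      have h2 := X_mul_resolventMoment A' v k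
      have h3 : v ⬝ᵥ A ^ k *ᵥ v = v ⬝ᵥ A' ^ k *ᵥ v := by
        rw [moment_eq_coeff hn, moment_eq_coeff hn, ih]
      rw [ih, hφ, h3] at h1
      exact add_right_cancel (h1.symm.trans h2)
  rw [moment_eq_coeff hn, moment_eq_coeff hn, key]

/-- The matrix on the left becomes `-(xI - A + J)`, and `J` is a rank-one update. So the
complement's spectrum carries exactly the information in `eᵀ adj(xI - A) e`. -/
theorem charpoly_compl_comp [IsDomain R] (A : Matrix (Fin n) (Fin n) R) :
    ((of 1 - 1 - A).charpoly).comp (-X - 1) =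
      (-1) ^ n * (A.charpoly + resolventMoment A 1 0) := by
  have h1 : A.charpoly + resolventMoment A 1 0 = (charmatrix A + vecMulVec 1 1).det := by
    have hC : (C ∘ (1 : Fin n → R) : Fin n → R[X]) = 1 := by ext1 i; simp
    rw [det_add_vecMulVec _ A.charpoly_monic.ne_zero, resolventMoment, pow_zero, Matrix.one_mul,
      hC]
    rfl
  have h2 : (-1 : R[X]) ^ n = (-1) ^ Fintype.card (Fin n) := by simp
  rw [h1, h2, ← det_neg]
  change (compRingHom (-X - 1)) (charmatrix (of 1 - 1 - A)).det = _
  rw [RingHom.map_det]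
  congr 1
  ext1 i j
  by_cases hij : i = j
  · subst hij
    simp [vecMulVec]
    ring
  · simp [vecMulVec, hij]
    ring

theorem moment_one_eq_of_charpoly_eq [IsDomain R] {A A' : Matrix (Fin n) (Fin n) R}
    (h : A.charpoly = A'.charpoly)
    (hc : (of 1 - 1 - A).charpoly = (of 1 - 1 - A').charpoly) (k : ℕ) :
    (1 : Fin n → R) ⬝ᵥ A ^ k *ᵥ 1 = 1 ⬝ᵥ A' ^ k *ᵥ 1 := by
  refine moment_eq_of_resolventMoment_eq h ?_ k
  have h1 := charpoly_compl_comp A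
  rw [hc, charpoly_compl_comp A', h] at h1
  have h2 := mul_left_cancel₀ (pow_ne_zero n (by simp : (-1 : R[X]) ≠ 0)) h1
  exact (add_left_cancel h2).symm

end Moments

/-! ### Substituting a matrix into polynomial vectors. -/

section EvalVec

variable {R : Type*} [CommRing R] {n : ℕ}

/-- Substitution of a matrix into a vector of polynomials kills the image of `x I - A`. -/
theorem sum_aeval_charmatrix_mulVec (A : Matrix (Fin n) (Fin n) R) (w : Fin n → R[X]) :
    ∑ j, aeval A ((charmatrix A *ᵥ w) j) *ᵥ (Pi.single j 1 : Fin n → R) = 0 := by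
  have hk (k : Fin n) : ∑ j, aeval A (charmatrix A j k) *ᵥ (Pi.single j 1 : Fin n → R) = 0 := by
    have (j : Fin n) : aeval A (charmatrix A j k) *ᵥ (Pi.single j 1 : Fin n → R) =
        (if j = k then A *ᵥ Pi.single k 1 else 0) - A j k • (Pi.single j 1 : Fin n → R) := by
      by_cases h : j = k
      · subst h
        rw [if_pos rfl, charmatrix_apply_eq, map_sub, aeval_X, aeval_C,
          Algebra.algebraMap_eq_smul_one, sub_mulVec, smul_mulVec, one_mulVec]
      · rw [if_neg h, charmatrix_apply_ne _ _ _ h, map_neg, aeval_C,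
          Algebra.algebraMap_eq_smul_one, neg_mulVec, smul_mulVec, one_mulVec, zero_sub]
    simp only [this, Finset.sum_sub_distrib, Finset.sum_ite_eq', Finset.mem_univ, if_true]
    ext i
    simp [Finset.sum_apply, Pi.single_apply]
  have hj (j : Fin n) : aeval A ((charmatrix A *ᵥ w) j) *ᵥ (Pi.single j 1 : Fin n → R) =
      ∑ k, aeval A (w k) *ᵥ (aeval A (charmatrix A j k) *ᵥ (Pi.single j 1 : Fin n → R)) := by
    simp only [mulVec_mulVec, ← map_mul, ← sum_mulVec, ← map_sum]
    simp [mulVec, dotProduct, mul_comm]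
  simp only [hj]
  rw [Finset.sum_comm]
  simp only [← mulVec_sum, hk, mulVec_zero, Finset.sum_const_zero]

theorem aeval_mulVec_eq_zero_of_charmatrix {A : Matrix (Fin n) (Fin n) R} {h : R[X]}
    {y : Fin n → R} {u : Fin n → R[X]} (hu : charmatrix A *ᵥ u = h • (C ∘ y)) :
    aeval A h *ᵥ y = 0 := by
  rw [← sum_aeval_charmatrix_mulVec A u, hu]
  simp only [Pi.smul_apply, Function.comp_apply, smul_eq_mul, map_mul, aeval_C, ← mulVec_mulVec,
    Algebra.algebraMap_eq_smul_one, smul_mulVec, one_mulVec, ← mulVec_sum]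
  congr 1
  ext i
  simp [Finset.sum_apply, Pi.single_apply]

end EvalVec

/-! ### Alternating matrices over `𝔽₂` and the square root of the characteristic polynomial. -/

section CharTwo

variable {n : ℕ}

theorem dotProduct_mulVec_self_eq_zero {R : Type*} [CommRing R] [CharP R 2]
    {A : Matrix (Fin n) (Fin n) R} (hA : A.IsSymm) (hd : ∀ i, A i i = 0) (x : Fin n → R) :
    x ⬝ᵥ A *ᵥ x = 0 := by
  have : x ⬝ᵥ A *ᵥ x = ∑ q : Fin n × Fin n, x q.1 * (A q.1 q.2 * x q.2) := by
    simp [dotProduct, mulVec, Fintype.sum_prod_type, Finset.mul_sum]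
  rw [this]
  refine Finset.sum_involution (fun q _ => q.swap) ?_ ?_ ?_ ?_
  · rintro ⟨i, j⟩ -
    have := hA.apply i j
    simp only [Prod.swap_prod_mk, this]
    rw [show x j * (A i j * x i) = x i * (A i j * x j) by ring]
    exact CharTwo.add_self_eq_zero _
  · rintro ⟨i, j⟩ - h heq
    simp only [Prod.swap_prod_mk, Prod.mk.injEq] at heq
    apply h
    simp [heq.1, hd]
  · simp
  · simp

theorem dotProduct_self_eq_sq {R : Type*} [CommRing R] [CharP R 2] (x : Fin n → R) :
    x ⬝ᵥ x = (1 ⬝ᵥ x) ^ 2 := by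
  simp only [dotProduct, Pi.one_apply, one_mul, CharTwo.sum_sq, ← sq]

/-- After removing `X^(n % 2)` only even exponents remain, and a polynomial in `X^2` over `𝔽₂` is a
square by Frobenius. -/
theorem exists_eq_X_pow_mul_sq {p : (ZMod 2)[X]} (hp : ∀ k, k % 2 ≠ n % 2 → p.coeff k = 0) :
    ∃ h : (ZMod 2)[X], p = X ^ (n % 2) * h ^ 2 := by
  refine ⟨contract 2 (divX^[n % 2] p), ?_⟩
  have hexp (q : (ZMod 2)[X]) : q ^ 2 = expand (ZMod 2) 2 q := (ZMod.expand_card q).symm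
  rw [hexp]
  rcases Nat.mod_two_eq_zero_or_one n with h | h
  · simp only [h, Function.iterate_zero, id, pow_zero, one_mul]
    ext k
    rw [coeff_expand two_pos, coeff_contract two_ne_zero]
    split_ifs with hk
    · rw [Nat.div_mul_cancel hk]
    · exact hp k (by omega)
  · simp only [h, Function.iterate_one, pow_one]
    ext k
    cases k with
    | zero => simpa using hp 0 (by omega)
    | succ k =>
      rw [coeff_X_mul, coeff_expand two_pos, coeff_contract two_ne_zero, coeff_divX]
      split_ifs with hk
      · rw [Nat.div_mul_cancel hk]
      · exact hp _ (by omega)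

theorem coeff_charpoly_eq_zero_of_skew {S : Matrix (Fin n) (Fin n) ℤ} (hS : Sᵀ = -S) {k : ℕ}
    (hk : k % 2 ≠ n % 2) : S.charpoly.coeff k = 0 := by
  have h1 : S.charpoly = (-1) ^ n * S.charpoly.comp (-X) := by
    conv_lhs => rw [← charpoly_transpose, hS]
    have h2 : (-1 : ℤ[X]) ^ n = (-1) ^ Fintype.card (Fin n) := by simp
    change _ = _ * compRingHom (-X) (charmatrix S).det
    rw [RingHom.map_det, h2, ← det_neg, Matrix.charpoly]
    congr 1
    ext1 i j
    by_cases hij : i = j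
    · subst hij; simp; ring
    · simp [hij]
  have h2 := congrArg (fun p => p.coeff k) h1
  have h3 : (-1 : ℤ[X]) ^ n = C ((-1) ^ n) := by simp
  simp only [h3, coeff_C_mul, show (-X : ℤ[X]) = C (-1) * X by simp, comp_C_mul_X_coeff] at h2
  rw [mul_left_comm, ← pow_add, Odd.neg_one_pow (by rw [Nat.odd_iff]; omega)] at h2
  linarith

theorem exists_charpoly_eq_X_pow_mul_sq {A : Matrix (Fin n) (Fin n) (ZMod 2)} (hA : A.IsSymm)
    (hd : ∀ i, A i i = 0) : ∃ h : (ZMod 2)[X], A.charpoly = X ^ (n % 2) * h ^ 2 := by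
  apply exists_eq_X_pow_mul_sq
  intro k hk
  -- A skew-symmetric integer lift of `A`, whose characteristic polynomial has only exponents of the
  -- parity of `n`.
  let S : Matrix (Fin n) (Fin n) ℤ := of fun i j =>
    if i < j then ((A i j).val : ℤ) else if j < i then -((A i j).val : ℤ) else 0
  have hS : Sᵀ = -S := by
    ext i j
    have := hA.apply i j
    rcases lt_trichotomy i j with h | h | h
    · simp [S, h, h.not_gt, this]
    · simp [S, h]
    · simp [S, h, h.not_gt, this]
  have hmap : A = S.map (Int.castRingHom (ZMod 2)) := by
    ext i j
    rcases lt_trichotomy i j with h | h | h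
    · simp [S, h]
    · simp [S, h, hd]
    · simp [S, h, h.not_gt, ZMod.neg_eq_self_mod_two]
  rw [hmap, charpoly_map, coeff_map, coeff_charpoly_eq_zero_of_skew hS hk, map_zero]

/-- For an alternating matrix `A` over `𝔽₂` with `A 1 = 0`, the square root of the characteristic
polynomial annihilates the orthogonal complement of the all-one vector. -/
theorem aeval_sqrt_charpoly_mulVec_eq_zero {A : Matrix (Fin n) (Fin n) (ZMod 2)} (hA : A.IsSymm)
    (hd : ∀ i, A i i = 0) (h1 : A *ᵥ 1 = 0) {ε : ℕ} (hε : ε ≤ 1) {h : (ZMod 2)[X]}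
    (hh : A.charpoly = X ^ ε * h ^ 2) {y : Fin n → ZMod 2} (hy : 1 ⬝ᵥ y = 0) :
    aeval A h *ᵥ y = 0 := by
  have hφ0 : A.charpoly ≠ 0 := A.charpoly_monic.ne_zero
  have hh0 : X ^ ε * h ≠ 0 := by
    rintro h0
    apply hφ0
    rw [hh, sq, ← mul_assoc, h0, zero_mul]
  set B := (charmatrix A).adjugate
  set w := B *ᵥ (C ∘ y) with hw
  have hBs : B.IsSymm := by
    have : (charmatrix A)ᵀ = charmatrix A := by rw [← charmatrix_transpose, hA.eq]
    rw [Matrix.IsSymm, adjugate_transpose, this]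
  have hMw : charmatrix A *ᵥ w = A.charpoly • (C ∘ y) := by
    rw [hw, mulVec_mulVec, mul_adjugate, smul_mulVec, one_mulVec]; rfl
  have hM (x : Fin n → (ZMod 2)[X]) : charmatrix A *ᵥ x =
      (X : (ZMod 2)[X]) • x - A.map (C : ZMod 2 →+* (ZMod 2)[X]) *ᵥ x := by
    rw [charmatrix, scalar_apply, ← smul_one_eq_diagonal, sub_mulVec, smul_mulVec, one_mulVec]
    rfl
  have hAs' : (A.map (C : ZMod 2 →+* (ZMod 2)[X])).IsSymm := hA.map _
  have h1' : A.map (C : ZMod 2 →+* (ZMod 2)[X]) *ᵥ (1 : Fin n → (ZMod 2)[X]) = 0 := by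
    ext1 i
    have := congrFun h1 i
    simp only [mulVec, dotProduct, map_apply, Pi.one_apply, mul_one, Pi.zero_apply] at this ⊢
    rw [← map_sum, this, map_zero]
  have h1w : 1 ⬝ᵥ w = 0 := by
    have h2 : (1 : Fin n → (ZMod 2)[X]) ⬝ᵥ (charmatrix A *ᵥ w) = X * (1 ⬝ᵥ w) := by
      rw [hM, dotProduct_sub, dotProduct_mulVec_comm hAs', h1', zero_dotProduct, sub_zero,
        dotProduct_smul, smul_eq_mul]
    have h3 : (1 : Fin n → (ZMod 2)[X]) ⬝ᵥ (C ∘ y) = 0 := by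
      have : (1 : Fin n → (ZMod 2)[X]) ⬝ᵥ (C ∘ y) = C (1 ⬝ᵥ y) := by simp [dotProduct]
      rw [this, hy, map_zero]
    rw [hMw, dotProduct_smul, h3, smul_zero] at h2
    exact (mul_eq_zero.mp h2.symm).resolve_left X_ne_zero
  -- Pair `(xI - A)w = φ y` with `w`: the alternating part vanishes and `w ⬝ᵥ w = (1 ⬝ᵥ w)^2 = 0`.
  have hyw : (C ∘ y) ⬝ᵥ w = 0 := by
    have h2 : w ⬝ᵥ (charmatrix A *ᵥ w) = 0 := by
      rw [hM, dotProduct_sub, dotProduct_mulVec_self_eq_zero hAs' (by simp [hd]),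
        dotProduct_smul, dotProduct_self_eq_sq, h1w]
      simp
    rw [hMw, dotProduct_smul, smul_eq_mul] at h2
    rw [dotProduct_comm]
    exact (mul_eq_zero.mp h2).resolve_left hφ0
  -- With `y ⬝ᵥ w = 0`, the adjugate minor of `y` and the `i`-th basis vector is `-(w i)^2`, so `X^ε
  -- h^2` divides `(w i)^2`.
  have hdvd (i : Fin n) : X ^ ε * h ∣ w i := by
    have h2 := det_dvd_adjugate_gram (charmatrix A) hφ0 (C ∘ y) (Pi.single i 1)
    change A.charpoly ∣ ((C ∘ y) ⬝ᵥ w) * _ - ((C ∘ y) ⬝ᵥ B *ᵥ _) * (_ ⬝ᵥ w) at h2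
    rw [hyw, zero_mul, zero_sub, dvd_neg, dotProduct_mulVec_comm hBs, ← hw, dotProduct_single_one,
      single_one_dotProduct, ← sq, hh] at h2
    have h3 : h ∣ w i := by
      refine (UniqueFactorizationMonoid.pow_dvd_pow_iff_dvd two_ne_zero).mp ?_
      exact (dvd_mul_left _ _).trans h2
    obtain ⟨c, hc⟩ := h3
    interval_cases ε
    · simpa using ⟨c, hc⟩
    · have hne : h ≠ 0 := by rintro rfl; simp at hh0
      rw [hc, mul_pow, mul_comm, pow_one] at h2
      have h4 := (mul_dvd_mul_iff_left (pow_ne_zero 2 hne)).mp h2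
      have h5 := prime_X.dvd_of_dvd_pow h4
      rw [hc, pow_one, mul_comm]
      exact mul_dvd_mul_left _ h5
  choose u hu using hdvd
  -- Cancelling `X^ε h` from `(xI - A)w = X^ε h^2 y` leaves `(xI - A)u = h y`.
  apply aeval_mulVec_eq_zero_of_charmatrix (u := u)
  have hwu : w = (X ^ ε * h) • u := by ext1 i; simp [hu]
  rw [hwu, mulVec_smul, hh] at hMw
  ext1 i
  have h2 := congrFun hMw i
  simp only [Pi.smul_apply, smul_eq_mul] at h2 ⊢
  apply mul_left_cancel₀ hh0
  rw [h2]; ring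

end CharTwo

/-! ### Primes dividing the Krylov determinant exactly once. -/

section Prime

variable {n : ℕ}

/-- `vᵀ q(A) v` is determined by the moments `vᵀ A^k v`. -/
theorem dotProduct_aeval_mulVec_eq {R : Type*} [CommRing R] {A A' : Matrix (Fin n) (Fin n) R}
    {v : Fin n → R} (hm : ∀ k, v ⬝ᵥ A ^ k *ᵥ v = v ⬝ᵥ A' ^ k *ᵥ v) (q : R[X]) :
    v ⬝ᵥ aeval A q *ᵥ v = v ⬝ᵥ aeval A' q *ᵥ v := by
  rw [aeval_mulVec_eq_sum A v (Nat.lt_succ_self _), aeval_mulVec_eq_sum A' v (Nat.lt_succ_self _)]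
  simp only [dotProduct_sum, dotProduct_smul, hm]

theorem krylov_gram {R : Type*} [CommRing R] {A : Matrix (Fin n) (Fin n) R} (hA : A.IsSymm)
    (v : Fin n → R) :
    (krylov A v)ᵀ * krylov A v = of fun i j : Fin n => v ⬝ᵥ A ^ (i + j : ℕ) *ᵥ v := by
  ext i j
  have : (A ^ (i : ℕ)).IsSymm := by simp [Matrix.IsSymm, transpose_pow, hA.eq]
  rw [of_apply, pow_add, ← mulVec_mulVec, dotProduct_mulVec_comm this]
  rfl

theorem krylov_gram_eq {R : Type*} [CommRing R] {A A' : Matrix (Fin n) (Fin n) R} (hA : A.IsSymm)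
    (hA' : A'.IsSymm) {v : Fin n → R} (hm : ∀ k, v ⬝ᵥ A ^ k *ᵥ v = v ⬝ᵥ A' ^ k *ᵥ v) :
    (krylov A v)ᵀ * krylov A v = (krylov A' v)ᵀ * krylov A' v := by
  rw [krylov_gram hA, krylov_gram hA']
  simp only [hm]

theorem det_krylov_sq_eq {R : Type*} [CommRing R] {A A' : Matrix (Fin n) (Fin n) R}
    (hA : A.IsSymm) (hA' : A'.IsSymm) {v : Fin n → R}
    (hm : ∀ k, v ⬝ᵥ A ^ k *ᵥ v = v ⬝ᵥ A' ^ k *ᵥ v) :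
    (krylov A v).det ^ 2 = (krylov A' v).det ^ 2 := by
  have := congrArg det (krylov_gram_eq hA hA' hm)
  rwa [det_mul, det_mul, det_transpose, det_transpose, ← sq, ← sq] at this

variable {p : ℕ} [Fact p.Prime]

/-- A monic polynomial of degree `k` that annihilates `v` modulo `p` yields an overlattice of
index `p^(n-k)` of the Krylov lattice. -/
theorem exists_lift_of_aeval_eq_zero (A : Matrix (Fin n) (Fin n) ℤ) (v : Fin n → ℤ)
    {r : (ZMod p)[X]} (hr : r.Monic) (hrn : r.natDegree < n)
    (h0 : aeval (A.map (Int.castRingHom (ZMod p))) r *ᵥ (Int.castRingHom (ZMod p) ∘ v) = 0) :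
    ∃ (P : ℤ[X]) (y : Fin n → ℤ), P.map (Int.castRingHom (ZMod p)) = r ∧
      aeval A P *ᵥ v = (p : ℤ) • y ∧ (krylov A v).det = (p : ℤ) ^ (n - r.natDegree) *
        (of fun i j : Fin n => if (j : ℕ) < r.natDegree then (A ^ (j : ℕ) *ᵥ v) i
          else (A ^ (j - r.natDegree : ℕ) *ᵥ y) i).det := by
  have hl : r ∈ lifts (Int.castRingHom (ZMod p)) := by
    rw [lifts_iff_coeff_lifts]
    exact fun k => ZMod.intCast_surjective _
  obtain ⟨P, hP, hPd, hPm⟩ := lifts_and_natDegree_eq_and_monic hl hr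
  have hdvd (i : Fin n) : (p : ℤ) ∣ (aeval A P *ᵥ v) i := by
    have h1 := congrFun (map_aeval_mulVec (Int.castRingHom (ZMod p)) A v P) i
    rw [hP, h0] at h1
    exact (ZMod.intCast_zmod_eq_zero_iff_dvd _ p).mp h1
  choose y hy using hdvd
  have hy' : aeval A P *ᵥ v = (p : ℤ) • y := by ext i; simp [hy]
  refine ⟨P, y, hP, hy', ?_⟩
  set k := r.natDegree with hk
  -- Monic of degree `j`, so the change of basis is unimodular; each of the last `n - k` columns
  -- contributes a factor `p`.
  let Q : Fin n → ℤ[X] := fun j => if (j : ℕ) < k then X ^ (j : ℕ) else X ^ (j - k : ℕ) * P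
  have hQm (j : Fin n) : (Q j).Monic := by
    by_cases h : (j : ℕ) < k
    · simp only [Q, if_pos h]; exact monic_X_pow _
    · simp only [Q, if_neg h]; exact (monic_X_pow _).mul hPm
  have hQd (j : Fin n) : (Q j).natDegree = j := by
    by_cases h : (j : ℕ) < k
    · simp [Q, if_pos h]
    · simp only [Q, if_neg h]
      rw [(monic_X_pow _).natDegree_mul hPm, natDegree_X_pow, hPd]; omega
  have h1 := det_polyKrylov A v (p := Q) (fun j => (hQd j).le)
  have h2 : ∏ j, (Q j).coeff j = 1 := by
    apply Finset.prod_eq_one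
    intro j _
    have := (hQm j).coeff_natDegree
    rwa [hQd] at this
  rw [h2, mul_one] at h1
  rw [← h1]
  have h3 : polyKrylov A v Q = (of fun i j : Fin n => if (j : ℕ) < k then (A ^ (j : ℕ) *ᵥ v) i
          else (A ^ (j - k : ℕ) *ᵥ y) i) *
        diagonal (fun j : Fin n => if (j : ℕ) < k then (1 : ℤ) else p) := by
    ext i j
    rw [mul_diagonal]
    by_cases h : (j : ℕ) < k
    · simp [polyKrylov, Q, h]
    · simp only [polyKrylov, Q, of_apply, if_neg h, map_mul, map_pow, aeval_X, ← mulVec_mulVec,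
        hy', mulVec_smul, Pi.smul_apply, smul_eq_mul]
      exact mul_comm _ _
  rw [h3, det_mul, det_diagonal, mul_comm]
  congr 1
  rw [Finset.prod_ite]
  simp only [Finset.prod_const_one, one_mul, Finset.prod_const, not_lt]
  congr 1
  have h4 := Finset.card_filter_add_card_filter_not (s := (Finset.univ : Finset (Fin n)))
    (fun j => (j : ℕ) < k)
  have h5 : (Finset.univ.filter fun j : Fin n => (j : ℕ) < k).card = k := by
    rw [Fin.card_filter_val_lt]; omega
  simp only [not_lt, Finset.card_univ, Fintype.card_fin] at h4
  omega

/-- If `p` divides the determinant of the Krylov matrix exactly once, the minimal polynomial of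
`v` modulo `p` has degree `n - 1`. -/
theorem natDegree_of_aeval_eq_zero (A : Matrix (Fin n) (Fin n) ℤ) (v : Fin n → ℤ)
    (h2 : ¬ (p : ℤ) ^ 2 ∣ (krylov A v).det) {r : (ZMod p)[X]} (hr : r ≠ 0) (hrn : r.natDegree < n)
    (h0 : aeval (A.map (Int.castRingHom (ZMod p))) r *ᵥ (Int.castRingHom (ZMod p) ∘ v) = 0) :
    r.natDegree + 1 = n := by
  have hc : r.leadingCoeff ≠ 0 := leadingCoeff_ne_zero.mpr hr
  have hmon : (r * C r.leadingCoeff⁻¹).Monic := monic_mul_leadingCoeff_inv hr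
  have hdeg : (r * C r.leadingCoeff⁻¹).natDegree = r.natDegree :=
    natDegree_mul_C (inv_ne_zero hc)
  obtain ⟨P, y, -, -, hd⟩ := exists_lift_of_aeval_eq_zero A v hmon (by omega) (by
    rw [mul_comm, map_mul, ← mulVec_mulVec, h0, mulVec_zero])
  rw [hdeg] at hd
  by_contra hne
  apply h2
  rw [hd]
  exact (pow_dvd_pow _ (by omega)).mul_right _

/-- A kernel vector of the Krylov matrix mod `p` is the coefficient vector of an annihilator of `v`;
its degree must be `n - 1`. By Cayley–Hamilton `g` divides the characteristic polynomial, leaving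
one linear factor. -/
theorem exists_krylov_minpoly (A : Matrix (Fin n) (Fin n) ℤ) (v : Fin n → ℤ)
    (h1 : (p : ℤ) ∣ (krylov A v).det) (h2 : ¬ (p : ℤ) ^ 2 ∣ (krylov A v).det) :
    ∃ (g : (ZMod p)[X]) (l : ZMod p), g.Monic ∧ g.natDegree + 1 = n ∧
      aeval (A.map (Int.castRingHom (ZMod p))) g *ᵥ (Int.castRingHom (ZMod p) ∘ v) = 0 ∧
      A.charpoly.map (Int.castRingHom (ZMod p)) = g * (X - C l) ∧
      ∀ r : (ZMod p)[X], r.natDegree < n →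
        aeval (A.map (Int.castRingHom (ZMod p))) r *ᵥ (Int.castRingHom (ZMod p) ∘ v) = 0 →
        ∃ c, r = C c * g := by
  set F := Int.castRingHom (ZMod p)
  have hn : 0 < n := by
    rcases Nat.eq_zero_or_pos n with rfl | h
    · rw [det_isEmpty] at h1
      exact absurd (Int.natCast_dvd_natCast.mp (by simpa using h1)) (Fact.out : p.Prime).not_dvd_one
    · exact h
  have hdet : (krylov (A.map F) (F ∘ v)).det = 0 := by
    rw [← krylov_map, ← RingHom.mapMatrix_apply, ← RingHom.map_det]
    exact (ZMod.intCast_zmod_eq_zero_iff_dvd _ p).mpr h1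
  obtain ⟨c, hc0, hc⟩ := exists_mulVec_eq_zero_iff.mpr hdet
  let r : (ZMod p)[X] := ∑ k : Fin n, monomial k (c k)
  have hrc (k : Fin n) : r.coeff k = c k := by
    simp [r, coeff_monomial, Fin.val_inj]
  have hrn : r.natDegree < n := by
    refine Nat.lt_of_le_pred hn (natDegree_sum_le_of_forall_le _ _ fun k _ => ?_)
    exact (natDegree_monomial_le _).trans (Nat.le_pred_of_lt k.2)
  have hr0 : r ≠ 0 := by
    rintro h
    apply hc0
    ext k
    rw [← hrc, h]; simp
  have hre : aeval (A.map F) r *ᵥ (F ∘ v) = 0 := by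
    rw [← krylov_mulVec_coeff _ _ hrn]
    simp only [hrc]; exact hc
  have hdeg := natDegree_of_aeval_eq_zero A v h2 hr0 hrn hre
  have hlc : r.leadingCoeff ≠ 0 := leadingCoeff_ne_zero.mpr hr0
  set g := r * C r.leadingCoeff⁻¹ with hg
  have hgm : g.Monic := monic_mul_leadingCoeff_inv hr0
  have hgd : g.natDegree + 1 = n := by
    rw [hg, natDegree_mul_C (inv_ne_zero hlc)]; exact hdeg
  have hge : aeval (A.map F) g *ᵥ (F ∘ v) = 0 := by
    rw [hg, mul_comm, map_mul, ← mulVec_mulVec, hre, mulVec_zero]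
  have huniq (s : (ZMod p)[X]) (hs : s.natDegree + 1 < n)
      (hse : aeval (A.map F) s *ᵥ (F ∘ v) = 0) : s = 0 := by
    by_contra hs0
    have := natDegree_of_aeval_eq_zero A v h2 hs0 (by omega) hse
    omega
  have hmod (s : (ZMod p)[X]) (hse : aeval (A.map F) s *ᵥ (F ∘ v) = 0) : g ∣ s := by
    rw [← modByMonic_eq_zero_iff_dvd hgm]
    by_contra hne
    have hdeg' : (s %ₘ g).natDegree < g.natDegree := by
      apply natDegree_modByMonic_lt _ hgm
      rintro h1
      rw [h1] at hne
      exact hne (modByMonic_one s)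
    refine hne (huniq _ (by omega) ?_)
    rw [modByMonic_eq_sub_mul_div s g, map_sub, sub_mulVec, hse, mul_comm, map_mul, ← mulVec_mulVec,
      hge, mulVec_zero, sub_zero]
  have hφ : A.charpoly.map F = (A.map F).charpoly := (charpoly_map A F).symm
  have hφd : (A.map F).charpoly.natDegree = n := by
    rw [charpoly_natDegree_eq_dim, Fintype.card_fin]
  obtain ⟨q, hq⟩ := hmod (A.map F).charpoly (by rw [aeval_self_charpoly, zero_mulVec])
  have hqm : q.Monic := hgm.of_mul_monic_left (hq ▸ charpoly_monic _)
  have hqd : q.natDegree = 1 := by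
    have := hgm.natDegree_mul hqm
    rw [← hq, hφd] at this
    omega
  refine ⟨g, -q.coeff 0, hgm, hgd, hge, ?_, ?_⟩
  · rw [hφ, hq]
    congr 1
    rw [hqm.eq_X_add_C hqd]
    simp
  · intro s hsn hse
    obtain ⟨b, hb⟩ := hmod s hse
    rcases eq_or_ne b 0 with rfl | hb0
    · exact ⟨0, by simp [hb]⟩
    · have hbd : b.natDegree = 0 := by
        have := natDegree_mul hgm.ne_zero hb0
        rw [← hb] at this
        omega
      exact ⟨b.coeff 0, by rw [hb, mul_comm, ← eq_C_of_natDegree_eq_zero hbd]⟩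

/-- Once the minimal polynomials `g` and `g'` mod `p` agree, the kernel of the first Krylov matrix
lies in that of the second. The columns of the adjugate lie in the first kernel. -/
theorem dvd_krylov_mul_adjugate {A A' : Matrix (Fin n) (Fin n) ℤ} (hA : A.IsSymm)
    {v : Fin n → ℤ} (hφ : A.charpoly = A'.charpoly)
    (hm : ∀ k, v ⬝ᵥ A ^ k *ᵥ v = v ⬝ᵥ A' ^ k *ᵥ v)
    (h1 : (p : ℤ) ∣ (krylov A v).det) (h2 : ¬ (p : ℤ) ^ 2 ∣ (krylov A v).det)
    (h1' : (p : ℤ) ∣ (krylov A' v).det) (h2' : ¬ (p : ℤ) ^ 2 ∣ (krylov A' v).det) (i j : Fin n) :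
    (p : ℤ) ∣ (krylov A' v * (krylov A v).adjugate) i j := by
  set F := Int.castRingHom (ZMod p) with hF
  obtain ⟨g, l, hgm, hgd, hge, hgφ, hgu⟩ := exists_krylov_minpoly A v h1 h2
  obtain ⟨g', l', hgm', hgd', hge', hgφ', -⟩ := exists_krylov_minpoly A' v h1' h2'
  rw [← hF] at hge hgφ hgu hge' hgφ'
  set a := A.map F with ha
  set a' := A'.map F with ha'
  set e := F ∘ v with he
  have has : a.IsSymm := hA.map _
  have hm' (k : ℕ) : e ⬝ᵥ a ^ k *ᵥ e = e ⬝ᵥ a' ^ k *ᵥ e := by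
    have hpow (B : Matrix (Fin n) (Fin n) ℤ) : F (v ⬝ᵥ B ^ k *ᵥ v) =
        e ⬝ᵥ (B.map F) ^ k *ᵥ e := by
      rw [RingHom.map_dotProduct, map_comp_pow_mulVec]
    rw [← hpow, ← hpow, hm]
  set t := aeval a g' *ᵥ e with ht
  have horth (s : (ZMod p)[X]) : t ⬝ᵥ aeval a s *ᵥ e = 0 := by
    -- Equal moments move the pairing from `A` to `A'`, where `g'` annihilates the vector.
    rw [ht, ← dotProduct_mulVec_comm (IsSymm.aeval has g'), mulVec_mulVec, ← map_mul,
      dotProduct_aeval_mulVec_eq hm', mul_comm, map_mul, ← mulVec_mulVec, hge', mulVec_zero,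
      dotProduct_zero]
  have hat : a *ᵥ t = l' • t := by
    have h3 : aeval a (A'.charpoly.map F) *ᵥ e = 0 := by
      rw [← hφ, ← charpoly_map, aeval_self_charpoly, zero_mulVec]
    rw [hgφ', mul_comm, map_mul, ← mulVec_mulVec, ← ht, map_sub, aeval_X, aeval_C, sub_mulVec,
      Algebra.algebraMap_eq_smul_one, smul_mulVec, one_mulVec] at h3
    exact sub_eq_zero.mp h3
  have hgg : g = g' := by
    by_cases ht0 : t = 0
    · obtain ⟨c, hc⟩ := hgu g' (by omega) ht0
      have hc1 : c = 1 := by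
        have := congrArg leadingCoeff hc
        rw [hgm'.leadingCoeff, leadingCoeff_mul, hgm.leadingCoeff, leadingCoeff_C, mul_one] at this
        exact this.symm
      rw [hc, hc1, C_1, one_mul]
    · obtain ⟨P, y, hP, hPy, hd⟩ := exists_lift_of_aeval_eq_zero A v hgm (by omega) hge
      have hnd : n - g.natDegree = 1 := by omega
      rw [hnd, pow_one] at hd
      set D : Matrix (Fin n) (Fin n) ℤ := of fun i j : Fin n =>
        if (j : ℕ) < g.natDegree then (A ^ (j : ℕ) *ᵥ v) i
          else (A ^ (j - g.natDegree : ℕ) *ᵥ y) i with hD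
      have hDp : (D.map F).det ≠ 0 := by
        rw [← RingHom.mapMatrix_apply, ← RingHom.map_det]
        intro h0
        obtain ⟨c, hc⟩ := (ZMod.intCast_zmod_eq_zero_iff_dvd _ p).mp h0
        exact h2 ⟨c, by rw [hd, hc]; ring⟩
      -- The overlattice matrix is invertible mod `p` and `t` is orthogonal to all its columns
      -- except the last, `y`.
      have hty : t ⬝ᵥ (F ∘ y) ≠ 0 := by
        intro h0
        apply hDp
        apply exists_vecMul_eq_zero_iff.mp
        refine ⟨t, ht0, ?_⟩
        ext j
        by_cases hj : (j : ℕ) < g.natDegree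
        · have := horth (X ^ (j : ℕ))
          rw [map_pow, aeval_X] at this
          rw [Pi.zero_apply, ← this]
          simp only [vecMul, hD, map_apply, of_apply, if_pos hj]
          rw [he, ha, ← map_comp_pow_mulVec]
          rfl
        · have hj0 : (j : ℕ) - g.natDegree = 0 := by omega
          rw [Pi.zero_apply, ← h0]
          simp only [vecMul, hD, map_apply, of_apply, if_neg hj, hj0, pow_zero, one_mulVec]
          rfl
      obtain ⟨L, hL⟩ := ZMod.intCast_surjective l
      have hs : C (p : ℤ) ∣ (X - C L) * P - A.charpoly := by
        rw [C_dvd_iff_dvd_coeff]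
        intro k
        rw [← ZMod.intCast_zmod_eq_zero_iff_dvd]
        change F _ = 0
        rw [← coeff_map]
        have : F L = l := hL
        rw [Polynomial.map_sub, Polynomial.map_mul, Polynomial.map_sub, map_X, map_C, this, hP, hgφ,
          mul_comm, sub_self, coeff_zero]
      obtain ⟨s, hs⟩ := hs
      have hp0 : (p : ℤ) ≠ 0 := by exact_mod_cast (Fact.out : p.Prime).ne_zero
      have h3 : A *ᵥ y - L • y = aeval A s *ᵥ v := by
        have h4 := congrArg (fun q => aeval A q *ᵥ v) hs
        simp only [map_sub, map_mul, aeval_self_charpoly, sub_zero, ← mulVec_mulVec, hPy, aeval_X,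
          aeval_C, Algebra.algebraMap_eq_smul_one, sub_mulVec, smul_mulVec, one_mulVec,
          mulVec_smul] at h4
        ext i
        have h5 := congrFun h4 i
        simp only [Pi.sub_apply, Pi.smul_apply, smul_eq_mul] at h5 ⊢
        apply mul_left_cancel₀ hp0
        rw [← h5]
      have h4 : a *ᵥ (F ∘ y) - l • (F ∘ y) = aeval a (s.map F) *ᵥ e := by
        rw [he, ha, ← map_aeval_mulVec, ← h3]
        ext i
        have : F L = l := hL
        rw [← map_comp_mulVec, Pi.sub_apply, Pi.smul_apply, Function.comp_apply,
          Function.comp_apply, Function.comp_apply, Pi.sub_apply, map_sub, Pi.smul_apply,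
          smul_eq_mul, smul_eq_mul, map_mul, this]
      have h5 := horth (s.map F)
      -- Pairing `(A - l)y`, a polynomial in `A` applied to `e`, with the eigenvector `t` gives `(l'
      -- - l)(t ⬝ᵥ y) = 0`. Equal roots leave equal cofactors.
      rw [← h4, dotProduct_sub, dotProduct_mulVec_comm has, hat, smul_dotProduct,
        dotProduct_smul, ← sub_smul, smul_eq_mul] at h5
      have hll : l' = l := sub_eq_zero.mp ((mul_eq_zero.mp h5).resolve_right hty)
      rw [hφ, hgφ', hll] at hgφ
      exact (mul_right_cancel₀ (X_sub_C_ne_zero l) hgφ).symm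
  have hw : krylov a e * (krylov a e).adjugate = 0 := by
    rw [mul_adjugate, ← krylov_map, ← RingHom.mapMatrix_apply, ← RingHom.map_det]
    have : F (krylov A v).det = 0 := (ZMod.intCast_zmod_eq_zero_iff_dvd _ p).mpr h1
    rw [this, zero_smul]
  have hker (c : Fin n → ZMod p) (hc : krylov a e *ᵥ c = 0) : krylov a' e *ᵥ c = 0 := by
    let r : (ZMod p)[X] := ∑ k : Fin n, monomial k (c k)
    have hrc (k : Fin n) : r.coeff k = c k := by
      simp [r, coeff_monomial, Fin.val_inj]
    have hrn : r.natDegree < n := by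
      refine Nat.lt_of_le_pred (by omega) (natDegree_sum_le_of_forall_le _ _ fun k _ => ?_)
      exact (natDegree_monomial_le _).trans (Nat.le_pred_of_lt k.2)
    have hc' : c = fun k : Fin n => r.coeff k := by ext k; rw [hrc]
    rw [hc', krylov_mulVec_coeff _ _ hrn] at hc ⊢
    obtain ⟨b, hb⟩ := hgu r hrn hc
    rw [hb, hgg, map_mul, ← mulVec_mulVec, hge', mulVec_zero]
  rw [← ZMod.intCast_zmod_eq_zero_iff_dvd]
  have h3 : F ((krylov A' v * (krylov A v).adjugate) i j) =
      (krylov a' e * (krylov a e).adjugate) i j := by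
    rw [he, ha, ha', ← krylov_map, ← krylov_map, ← RingHom.mapMatrix_apply F (krylov A v),
      ← RingHom.map_adjugate, RingHom.mapMatrix_apply, ← Matrix.map_mul, map_apply]
  change F _ = 0
  rw [h3]
  have h4 := hker (fun k => (krylov a e).adjugate k j) (by
    ext i
    exact congrFun (congrFun hw i) j)
  exact congrFun h4 i

end Prime

/-! ### The half-degree relation modulo 2. -/

section Even

variable {n : ℕ}

theorem aeval_mulVec_of_mulVec_eq_zero {R : Type*} [CommRing R] {A : Matrix (Fin n) (Fin n) R}
    {v : Fin n → R} (h : A *ᵥ v = 0) (p : R[X]) : aeval A p *ᵥ v = p.coeff 0 • v := by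
  conv_lhs => rw [← divX_mul_X_add p]
  rw [map_add, map_mul, aeval_X, aeval_C, add_mulVec, ← mulVec_mulVec, h, mulVec_zero, zero_add,
    Algebra.algebraMap_eq_smul_one, smul_mulVec, one_mulVec]

/-- For `k = 2i` the value is `(1 ⬝ᵥ A^i f)^2`, zero since `A 1 = 0`; for `k = 2i + 1` it is the
alternating form at `A^i f`. -/
theorem dotProduct_pow_mulVec_self_eq_zero {A : Matrix (Fin n) (Fin n) (ZMod 2)} (hA : A.IsSymm)
    (hd : ∀ i, A i i = 0) (h1 : A *ᵥ 1 = 0) (f : Fin n → ZMod 2) {k : ℕ} (hk : k ≠ 0) :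
    f ⬝ᵥ A ^ k *ᵥ f = 0 := by
  have hpow (i : ℕ) : (A ^ i).IsSymm := by simp [Matrix.IsSymm, transpose_pow, hA.eq]
  rcases Nat.even_or_odd' k with ⟨i, rfl | rfl⟩
  · rw [two_mul, pow_add, ← mulVec_mulVec, dotProduct_mulVec_comm (hpow i), dotProduct_self_eq_sq,
      dotProduct_mulVec_comm (hpow i)]
    obtain ⟨j, rfl⟩ := Nat.exists_eq_succ_of_ne_zero (by omega : i ≠ 0)
    rw [pow_succ A, ← mulVec_mulVec, h1, mulVec_zero, zero_dotProduct, sq, mul_zero]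
  · rw [two_mul, pow_succ, pow_add, mul_assoc, ← pow_succ, pow_succ', ← mulVec_mulVec,
      ← mulVec_mulVec, dotProduct_mulVec_comm (hpow i)]
    exact dotProduct_mulVec_self_eq_zero hA hd _

/-- Modulo 2, the square root `h` of the characteristic polynomial maps every vector `f` to an
explicit multiple of the all-one vector. -/
theorem aeval_sqrt_charpoly_mulVec {A : Matrix (Fin n) (Fin n) (ZMod 2)} (hA : A.IsSymm)
    (hd : ∀ i, A i i = 0) (h1 : A *ᵥ 1 = 0) {h : (ZMod 2)[X]}
    (hh : A.charpoly = X ^ (n % 2) * h ^ 2) (f : Fin n → ZMod 2) :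
    aeval A h *ᵥ f = ((n : ZMod 2) * (1 ⬝ᵥ f) * h.coeff 0) • 1 := by
  have key {y : Fin n → ZMod 2} (hy : 1 ⬝ᵥ y = 0) : aeval A h *ᵥ y = 0 :=
    aeval_sqrt_charpoly_mulVec_eq_zero hA hd h1 (by omega) hh hy
  have hcase (x : ZMod 2) : x = 0 ∨ x = 1 := by revert x; decide
  rcases hcase (1 ⬝ᵥ f) with hf | hf
  · rw [hf, key hf]; simp
  rw [hf, mul_one]
  rcases Nat.mod_two_eq_zero_or_one n with hn | hn
  · have hn0 : (n : ZMod 2) = 0 := by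
      rw [ZMod.natCast_eq_zero_iff]; omega
    rw [hn0, zero_mul, zero_smul]
    set w := aeval A h *ᵥ f with hw
    -- For even `n`, `h(A)f` is orthogonal to everything orthogonal to `1`, hence constant; the
    -- pairing with `f` then reads off this constant.
    have hwy (y : Fin n → ZMod 2) (hy : 1 ⬝ᵥ y = 0) : y ⬝ᵥ w = 0 := by
      rw [hw, dotProduct_mulVec_comm (IsSymm.aeval hA h), key hy, zero_dotProduct]
    have hwc (i j : Fin n) : w i = w j := by
      have h2 := hwy (Pi.single i 1 + Pi.single j 1) (by
        rw [dotProduct_add, dotProduct_single_one, dotProduct_single_one]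
        exact CharTwo.add_self_eq_zero _)
      rw [add_dotProduct, single_one_dotProduct, single_one_dotProduct] at h2
      exact CharTwo.add_eq_zero.mp h2
    have hfw : f ⬝ᵥ w = 0 := by
      rw [hw, aeval_mulVec_eq_sum A f (Nat.lt_succ_self _), dotProduct_sum]
      apply Finset.sum_eq_zero
      intro k _
      rw [dotProduct_smul, smul_eq_mul]
      rcases eq_or_ne k 0 with rfl | hk
      -- The constant term of `h` vanishes because `A` is singular.
      · have hne : (1 : Fin n → ZMod 2) ≠ 0 := by
          rintro h0
          rw [h0, zero_dotProduct] at hf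
          exact zero_ne_one hf
        have hdet : A.det = 0 := exists_mulVec_eq_zero_iff.mp ⟨1, hne, h1⟩
        have h3 : A.charpoly.coeff 0 = 0 := by
          rw [det_eq_sign_charpoly_coeff] at hdet
          exact (mul_eq_zero.mp hdet).resolve_left (by simp)
        rw [hh, hn, pow_zero, one_mul, coeff_zero_eq_eval_zero, eval_pow,
          ← coeff_zero_eq_eval_zero] at h3
        rw [pow_eq_zero_iff two_ne_zero |>.mp h3, zero_mul]
      · rw [dotProduct_pow_mulVec_self_eq_zero hA hd h1 f hk, mul_zero]
    ext i
    have hwi : w = w i • 1 := by ext j; simp [hwc j i]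
    rw [hwi, dotProduct_smul, dotProduct_comm, hf, smul_eq_mul, mul_one] at hfw
    exact hfw
  · have hn1 : (n : ZMod 2) = 1 := by
      have : (n : ZMod 2) = ((1 : ℕ) : ZMod 2) := (ZMod.natCast_eq_natCast_iff' _ _ _).mpr hn
      simpa using this
    -- For odd `n`, `1 ⬝ᵥ 1 = 1`, so `f + 1` is orthogonal to `1`.
    have h2 : aeval A h *ᵥ (f + 1) = 0 := key (by
      rw [dotProduct_add, hf]
      have : (1 : Fin n → ZMod 2) ⬝ᵥ 1 = n := by simp [dotProduct]
      rw [this, hn1]; exact CharTwo.add_self_eq_zero 1)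
    rw [mulVec_add, aeval_mulVec_of_mulVec_eq_zero h1] at h2
    rw [hn1, one_mul]
    ext i
    have h3 := congrFun h2 i
    exact CharTwo.add_eq_zero.mp h3

theorem exists_half_vector {A : Matrix (Fin n) (Fin n) ℤ} (hA : A.IsSymm)
    (hd : ∀ i, A i i = 0) {f : Fin n → ℤ} (hf : A *ᵥ 1 = (2 : ℤ) • f) {h : ℤ[X]}
    (hh : A.charpoly.map (Int.castRingHom (ZMod 2)) =
      X ^ (n % 2) * h.map (Int.castRingHom (ZMod 2)) ^ 2) :
    ∃ v : Fin n → ℤ, aeval A h *ᵥ f = (n * (1 ⬝ᵥ f) * h.coeff 0) • 1 + (2 : ℤ) • v := by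
  set F := Int.castRingHom (ZMod 2)
  have hF1 : F ∘ (1 : Fin n → ℤ) = 1 := by ext; simp
  have h2 : (2 : ZMod 2) = 0 := rfl
  have h1 : A.map F *ᵥ 1 = 0 := by
    rw [← hF1, ← map_comp_mulVec, hf]
    ext i
    simp [h2]
  have key := aeval_sqrt_charpoly_mulVec (hA.map F) (by simp [hd]) h1
    (by rw [charpoly_map, hh]) (F ∘ f)
  rw [← map_aeval_mulVec] at key
  have hdvd (i : Fin n) :
      (2 : ℤ) ∣ (aeval A h *ᵥ f) i - n * (1 ⬝ᵥ f) * h.coeff 0 := by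
    have h3 := congrFun key i
    have h4 : (1 : Fin n → ZMod 2) ⬝ᵥ (F ∘ f) = F (1 ⬝ᵥ f) := by
      rw [RingHom.map_dotProduct, hF1]
    rw [h4] at h3
    refine (ZMod.intCast_zmod_eq_zero_iff_dvd _ 2).mp ?_
    change F _ = 0
    rw [map_sub, sub_eq_zero]
    refine h3.trans ?_
    simp
  choose v hv using hdvd
  refine ⟨v, ?_⟩
  ext i
  have := hv i
  simp
  linarith

end Even

/-! ### A polynomial basis exposing the powers of two. -/

section Basis

variable {n : ℕ}

/-- Monic polynomials of degree `j` whose values at the all-one vector are divisible by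
`latticeScale`. -/
noncomputable def latticePoly (h : ℤ[X]) (ε : ℤ) (j : Fin n) : ℤ[X] :=
  if (j : ℕ) ≤ n / 2 then X ^ (j : ℕ) else X ^ (j - n / 2 - 1 : ℕ) * (h * X - C (2 * ε))

/-- The guaranteed powers of two dividing the vectors `latticePoly h ε j (A) 1`. -/
def latticeScale (j : Fin n) : ℤ :=
  2 ^ (if (j : ℕ) = 0 then 0 else if (j : ℕ) ≤ n / 2 then 1 else 2)

theorem natDegree_latticePoly {h : ℤ[X]} (hm : h.Monic) (hd : h.natDegree = n / 2) (ε : ℤ)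
    (j : Fin n) : (latticePoly h ε j).natDegree = j ∧ (latticePoly h ε j).Monic := by
  unfold latticePoly
  split_ifs with hj
  · exact ⟨natDegree_X_pow _, monic_X_pow _⟩
  · have h1 : (h * X).Monic := hm.mul monic_X
    have h2 : (h * X).natDegree = n / 2 + 1 := by rw [hm.natDegree_mul monic_X, hd, natDegree_X]
    have h3 : (C (2 * ε)).degree < (h * X).degree := by
      apply lt_of_le_of_lt degree_C_le
      rw [← natDegree_pos_iff_degree_pos, h2]
      omega
    have h4 : (h * X - C (2 * ε)).Monic := h1.sub_of_left h3
    have h5 : (h * X - C (2 * ε)).natDegree = n / 2 + 1 := by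
      rw [natDegree_sub_C, h2]
    refine ⟨?_, (monic_X_pow _).mul h4⟩
    rw [(monic_X_pow _).natDegree_mul h4, natDegree_X_pow, h5]
    omega

theorem det_coeffMatrix_latticePoly {h : ℤ[X]} (hm : h.Monic) (hd : h.natDegree = n / 2) (ε : ℤ) :
    (coeffMatrix (latticePoly h ε : Fin n → ℤ[X])).det = 1 := by
  rw [det_coeffMatrix fun j => (natDegree_latticePoly hm hd ε j).1.le]
  apply Finset.prod_eq_one
  intro j _
  have := natDegree_latticePoly hm hd ε j
  have h1 := this.2.coeff_natDegree
  rwa [this.1] at h1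

/-- For `n ≥ 1` the exponent is `⌊n/2⌋ + 2(n - 1 - ⌊n/2⌋)`; truncated subtraction covers `n = 0`. -/
theorem prod_latticeScale : ∏ j : Fin n, latticeScale j = 2 ^ ((3 * n - 3) / 2) := by
  simp only [latticeScale]
  rw [Finset.prod_pow_eq_pow_sum,
    Fin.sum_univ_eq_sum_range (fun j => if j = 0 then 0 else if j ≤ n / 2 then 1 else 2)]
  congr 1
  have (d m : ℕ) : ∑ j ∈ Finset.range m, (if j = 0 then 0 else if j ≤ d then 1 else 2) =
      if m ≤ d + 1 then m - 1 else d + 2 * (m - d - 1) := by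
    induction m with
    | zero => simp
    | succ m ih =>
      rw [Finset.sum_range_succ, ih]
      split_ifs <;> omega
  rw [this]
  split_ifs <;> omega

theorem exists_polyKrylov_eq_mul_diagonal {A : Matrix (Fin n) (Fin n) ℤ} {f v : Fin n → ℤ}
    (hf : A *ᵥ 1 = (2 : ℤ) • f) {h : ℤ[X]} {ε : ℤ}
    (hv : aeval A h *ᵥ f = ε • 1 + (2 : ℤ) • v) :
    ∃ U : Matrix (Fin n) (Fin n) ℤ,
      polyKrylov A 1 (latticePoly h ε) = U * diagonal latticeScale := by
  refine ⟨of fun i j => if (j : ℕ) = 0 then 1 else if (j : ℕ) ≤ n / 2 then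
    (A ^ (j - 1 : ℕ) *ᵥ f) i else (A ^ (j - n / 2 - 1 : ℕ) *ᵥ v) i, ?_⟩
  ext i j
  rw [mul_diagonal]
  simp only [polyKrylov, latticePoly, latticeScale, of_apply]
  by_cases hj0 : (j : ℕ) = 0
  · simp [hj0]
  by_cases hj : (j : ℕ) ≤ n / 2
  · obtain ⟨k, hk⟩ := Nat.exists_eq_succ_of_ne_zero hj0
    rw [hk] at hj
    simp only [hk, if_pos hj, Nat.succ_ne_zero, if_false, map_pow, aeval_X, Nat.succ_sub_one,
      pow_succ A, ← mulVec_mulVec, hf, mulVec_smul, Pi.smul_apply, smul_eq_mul]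
    rw [pow_one, mul_comm]
  · simp only [if_neg hj0, if_neg hj, map_mul, map_pow, aeval_X, map_sub, aeval_C, sub_mulVec,
      ← mulVec_mulVec, hf, mulVec_smul, hv, Algebra.algebraMap_eq_smul_one, smul_mulVec,
      one_mulVec]
    have : (2 : ℤ) • (ε • (1 : Fin n → ℤ) + (2 : ℤ) • v) - ε • (2 : ℤ) • 1 = (4 : ℤ) • v := by
      ext k
      simp
      ring
    rw [this, mulVec_smul, Pi.smul_apply, smul_eq_mul]
    ring

end Basis

/-! ### Integrality and orthogonality of the transition matrix. -/

section Rigidity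

variable {n : ℕ}

theorem exists_monic_sqrt_charpoly {A : Matrix (Fin n) (Fin n) ℤ} (hA : A.IsSymm)
    (hd : ∀ i, A i i = 0) : ∃ h : ℤ[X], h.Monic ∧ h.natDegree = n / 2 ∧
      A.charpoly.map (Int.castRingHom (ZMod 2)) =
        X ^ (n % 2) * h.map (Int.castRingHom (ZMod 2)) ^ 2 := by
  obtain ⟨h, hh⟩ := exists_charpoly_eq_X_pow_mul_sq (hA.map (Int.castRingHom (ZMod 2)))
    (by simp [hd])
  have h0 : h ≠ 0 := by
    rintro rfl
    exact (charpoly_monic (A.map (Int.castRingHom (ZMod 2)))).ne_zero (by rw [hh]; simp)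
  have hmon : h.Monic := by
    have hcase (x : ZMod 2) (hx : x ≠ 0) : x = 1 := by revert x; decide
    exact hcase _ (leadingCoeff_ne_zero.mpr h0)
  have hdeg : h.natDegree = n / 2 := by
    have h1 := congrArg natDegree hh
    rw [charpoly_natDegree_eq_dim, Fintype.card_fin, (monic_X_pow _).natDegree_mul (hmon.pow 2),
      natDegree_X_pow, natDegree_pow] at h1
    omega
  have hl : h ∈ lifts (Int.castRingHom (ZMod 2)) := by
    rw [lifts_iff_coeff_lifts]
    intro k
    obtain ⟨a, ha⟩ := ZMod.intCast_surjective (h.coeff k)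
    exact ⟨a, ha⟩
  obtain ⟨P, hP, hPd, hPm⟩ := lifts_and_natDegree_eq_and_monic hl hmon
  exact ⟨P, hPm, hPd.trans hdeg, by rw [hP, ← hh, charpoly_map]⟩

theorem dvd_of_forall_prime_dvd {q y : ℤ} (hq : Squarefree q)
    (h : ∀ p : ℕ, p.Prime → (p : ℤ) ∣ q → (p : ℤ) ∣ y) : q ∣ y := by
  rw [← Int.natAbs_dvd_natAbs]
  have hq' : Squarefree q.natAbs := Int.squarefree_natAbs.mpr hq
  rw [← Nat.prod_primeFactors_of_squarefree hq']
  refine Finset.prod_primes_dvd _ (fun p hp => (Nat.prime_of_mem_primeFactors hp).prime)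
    fun p hp => ?_
  exact Int.natCast_dvd.mp (h p (Nat.prime_of_mem_primeFactors hp)
    (Int.natCast_dvd.mpr (Nat.dvd_of_mem_primeFactors hp)))

theorem det_krylov_eq_of_polyKrylov_eq {A U : Matrix (Fin n) (Fin n) ℤ} {h : ℤ[X]} {ε : ℤ}
    (hm : h.Monic) (hd : h.natDegree = n / 2)
    (hU : polyKrylov A 1 (latticePoly h ε) = U * diagonal latticeScale) :
    (krylov A 1).det = 2 ^ ((3 * n - 3) / 2) * U.det := by
  have h1 := polyKrylov_eq A 1 fun j : Fin n => (natDegree_latticePoly hm hd ε j).1.le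
  have h2 := congrArg det (h1.symm.trans hU)
  rw [det_mul, det_mul, det_coeffMatrix_latticePoly hm hd, det_diagonal, prod_latticeScale,
    mul_one] at h2
  rw [h2, mul_comm]

theorem exists_basis_change {A : Matrix (Fin n) (Fin n) ℤ} (hA : A.IsSymm)
    (hd : ∀ i, A i i = 0) {f : Fin n → ℤ} (hf : A *ᵥ 1 = (2 : ℤ) • f) {h : ℤ[X]}
    (hh : A.charpoly.map (Int.castRingHom (ZMod 2)) =
      X ^ (n % 2) * h.map (Int.castRingHom (ZMod 2)) ^ 2) :
    ∃ U : Matrix (Fin n) (Fin n) ℤ,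
      polyKrylov A 1 (latticePoly h (n * (1 ⬝ᵥ f) * h.coeff 0)) = U * diagonal latticeScale := by
  obtain ⟨v, hv⟩ := exists_half_vector hA hd hf hh
  exact exists_polyKrylov_eq_mul_diagonal hf hv

theorem two_pow_dvd_det_krylov {A : Matrix (Fin n) (Fin n) ℤ} (hA : A.IsSymm)
    (hd : ∀ i, A i i = 0) {f : Fin n → ℤ} (hf : A *ᵥ 1 = (2 : ℤ) • f) :
    (2 : ℤ) ^ ((3 * n - 3) / 2) ∣ (krylov A 1).det := by
  obtain ⟨h, hm, hdeg, hh⟩ := exists_monic_sqrt_charpoly hA hd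
  obtain ⟨U, hU⟩ := exists_basis_change hA hd hf hh
  exact ⟨_, det_krylov_eq_of_polyKrylov_eq hm hdeg hU⟩

theorem sq_not_dvd_two_pow_mul {p : ℕ} (hp : p.Prime) {q : ℤ} {k : ℕ} (hodd : Odd q)
    (hsq : Squarefree q) (hpq : (p : ℤ) ∣ q) :
    IsCoprime (p : ℤ) (2 ^ k) ∧ ¬ (p : ℤ) ^ 2 ∣ 2 ^ k * q := by
  have hp' : Prime (p : ℤ) := Nat.prime_iff_prime_int.mp hp
  have hpo : Odd (p : ℤ) := by
    obtain ⟨c, rfl⟩ := hpq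
    exact (Int.odd_mul.mp hodd).1
  have hcop : IsCoprime (p : ℤ) (2 ^ k) := by
    obtain ⟨c, hc⟩ := hpo
    exact IsCoprime.pow_right ⟨1, -c, by rw [hc]; ring⟩
  refine ⟨hcop, fun h => ?_⟩
  have h1 := (hcop.pow_left (m := 2)).dvd_of_dvd_mul_left h
  rw [sq] at h1
  exact hp'.not_isUnit (hsq _ h1)

/-- The common base change cancels the powers of two, and squarefreeness reduces divisibility by `q`
to one odd prime at a time. -/
theorem exists_mul_krylov_eq {A A' : Matrix (Fin n) (Fin n) ℤ} (hA : A.IsSymm) (hA' : A'.IsSymm)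
    (hd : ∀ i, A i i = 0) (hd' : ∀ i, A' i i = 0) {f f' : Fin n → ℤ}
    (hf : A *ᵥ 1 = (2 : ℤ) • f) (hf' : A' *ᵥ 1 = (2 : ℤ) • f')
    (hφ : A.charpoly = A'.charpoly)
    (hm : ∀ k, (1 : Fin n → ℤ) ⬝ᵥ A ^ k *ᵥ 1 = 1 ⬝ᵥ A' ^ k *ᵥ 1) {q : ℤ}
    (hq : (krylov A 1).det = 2 ^ ((3 * n - 3) / 2) * q) (hodd : Odd q) (hsq : Squarefree q) :
    ∃ Q : Matrix (Fin n) (Fin n) ℤ, Q * krylov A 1 = krylov A' 1 := by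
  obtain ⟨h, hmon, hdeg, hh⟩ := exists_monic_sqrt_charpoly hA hd
  obtain ⟨U, hU⟩ := exists_basis_change hA hd hf hh
  obtain ⟨U', hU'⟩ := exists_basis_change hA' hd' hf' (hφ ▸ hh)
  -- The number of edges is the first-moment datum in `ε`, so both graphs share the same `ε`.
  have hff : (1 : Fin n → ℤ) ⬝ᵥ f' = 1 ⬝ᵥ f := by
    have h1 := hm 1
    rw [pow_one, pow_one, hf, hf', dotProduct_smul, dotProduct_smul, smul_eq_mul,
      smul_eq_mul] at h1
    linarith
  rw [hff] at hU'
  set ε : ℤ := n * (1 ⬝ᵥ f) * h.coeff 0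
  have hdet := det_krylov_eq_of_polyKrylov_eq hmon hdeg hU
  set k := (3 * n - 3) / 2
  have h2k : (2 : ℤ) ^ k ≠ 0 := pow_ne_zero _ two_ne_zero
  have hUq : U.det = q := mul_left_cancel₀ h2k (hdet.symm.trans hq)
  have hq0 : q ≠ 0 := hsq.ne_zero
  have hT (B : Matrix (Fin n) (Fin n) ℤ) := polyKrylov_eq B 1 fun j : Fin n =>
    (natDegree_latticePoly hmon hdeg ε j).1.le
  set T : Matrix (Fin n) (Fin n) ℤ := coeffMatrix (latticePoly h ε)
  have hTd : T.det = 1 := det_coeffMatrix_latticePoly hmon hdeg ε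
  rw [hT] at hU hU'
  have hadj : krylov A' 1 * (krylov A 1).adjugate = (2 : ℤ) ^ k • (U' * U.adjugate) := by
    have h1 : (krylov A' 1 * T) * (krylov A 1 * T).adjugate =
        krylov A' 1 * (krylov A 1).adjugate := by
      rw [adjugate_mul_distrib, Matrix.mul_assoc, ← Matrix.mul_assoc T, mul_adjugate, hTd,
        one_smul, Matrix.one_mul]
    rw [← h1, hU, hU', adjugate_mul_distrib, Matrix.mul_assoc, ← Matrix.mul_assoc (diagonal _),
      mul_adjugate, det_diagonal, prod_latticeScale, Matrix.smul_mul, Matrix.one_mul,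
      Matrix.mul_smul]
  have hdet2 := det_krylov_sq_eq hA hA' hm
  have hdvd (i j : Fin n) : q ∣ (U' * U.adjugate) i j := by
    apply dvd_of_forall_prime_dvd hsq
    intro p hp hpq
    have : Fact p.Prime := ⟨hp⟩
    have hp' : Prime (p : ℤ) := Nat.prime_iff_prime_int.mp hp
    obtain ⟨hcop, hnd⟩ := sq_not_dvd_two_pow_mul (k := k) hp hodd hsq hpq
    have hpd : (p : ℤ) ∣ (krylov A 1).det := hq ▸ hpq.mul_left _
    rw [← hq] at hnd
    have hpd' : (p : ℤ) ∣ (krylov A' 1).det :=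
      hp'.dvd_of_dvd_pow (hdet2 ▸ dvd_pow hpd two_ne_zero)
    -- The two determinants have equal squares, so exact divisibility by `p` transfers.
    have hnd' : ¬ (p : ℤ) ^ 2 ∣ (krylov A' 1).det := by
      intro h1
      apply hnd
      rw [← Int.pow_dvd_pow_iff two_ne_zero, hdet2]
      exact pow_dvd_pow_of_dvd h1 2
    have h1 := dvd_krylov_mul_adjugate hA hφ hm hpd hnd hpd' hnd' i j
    rw [hadj, Matrix.smul_apply, smul_eq_mul] at h1
    exact hcop.dvd_of_dvd_mul_left h1
  choose Q hQ using hdvd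
  refine ⟨of Q, ?_⟩
  have hdet0 : (krylov A 1).det ≠ 0 := by rw [hq]; exact mul_ne_zero h2k hq0
  apply smul_right_injective _ hdet0
  have h1 : (krylov A 1).det • of Q = krylov A' 1 * (krylov A 1).adjugate := by
    rw [hadj, hq, mul_smul]
    congr 1
    ext i j
    simp [hQ]
  change (krylov A 1).det • (of Q * krylov A 1) = (krylov A 1).det • krylov A' 1
  rw [← Matrix.smul_mul, h1, Matrix.mul_assoc, adjugate_mul, Matrix.mul_smul, Matrix.mul_one]

/-- The columns give only degrees below `n`; reduction modulo the common characteristic polynomial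
gives the rest. -/
theorem mul_aeval_mulVec_of_mul_krylov {R : Type*} [CommRing R] [Nontrivial R]
    {A A' Q : Matrix (Fin n) (Fin n) R} {v : Fin n → R} (hφ : A.charpoly = A'.charpoly)
    (hQ : Q * krylov A v = krylov A' v) (p : R[X]) :
    Q *ᵥ (aeval A p *ᵥ v) = aeval A' p *ᵥ v := by
  rcases eq_or_ne n 0 with rfl | hn
  · exact Subsingleton.elim _ _
  have hmod (B : Matrix (Fin n) (Fin n) R) (hB : B.charpoly = A'.charpoly) :
      aeval B p = aeval B (p %ₘ A'.charpoly) := by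
    conv_lhs => rw [← modByMonic_add_div p A'.charpoly]
    rw [map_add, map_mul, ← hB, aeval_self_charpoly, zero_mul, add_zero]
  have hdeg : (p %ₘ A'.charpoly).natDegree < n := by
    have hd : A'.charpoly.natDegree = n := by rw [charpoly_natDegree_eq_dim, Fintype.card_fin]
    have h1 := natDegree_modByMonic_lt p A'.charpoly_monic (by
      intro h1
      rw [h1, natDegree_one] at hd
      exact hn hd.symm)
    rwa [hd] at h1
  rw [hmod A hφ, hmod A' rfl, ← krylov_mulVec_coeff A v hdeg, ← krylov_mulVec_coeff A' v hdeg,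
    mulVec_mulVec, hQ]

theorem eq_of_mul_eq_mul_of_det_ne_zero {R : Type*} [CommRing R] [IsDomain R]
    {M N W : Matrix (Fin n) (Fin n) R} (hW : W.det ≠ 0) (h : M * W = N * W) : M = N := by
  have h1 := congrArg (· * W.adjugate) h
  simp only [Matrix.mul_assoc, mul_adjugate, Matrix.mul_smul, Matrix.mul_one] at h1
  exact smul_right_injective _ hW h1

theorem orthogonal_of_mul_krylov {R : Type*} [CommRing R] [IsDomain R]
    {A A' Q : Matrix (Fin n) (Fin n) R} {v : Fin n → R} (hA : A.IsSymm) (hA' : A'.IsSymm)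
    (hφ : A.charpoly = A'.charpoly)
    (hm : ∀ k, v ⬝ᵥ A ^ k *ᵥ v = v ⬝ᵥ A' ^ k *ᵥ v) (hdet : (krylov A v).det ≠ 0)
    (hQ : Q * krylov A v = krylov A' v) :
    Qᵀ * Q = 1 ∧ Q *ᵥ v = v ∧ Q * A = A' * Q := by
  have hp := mul_aeval_mulVec_of_mul_krylov hφ hQ
  refine ⟨?_, by simpa using hp 1, ?_⟩
  · have hG := krylov_gram_eq hA hA' hm
    rw [← hQ, transpose_mul, Matrix.mul_assoc] at hG
    have h1 : (Qᵀ * Q) * krylov A v = 1 * krylov A v := by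
      have h2 := congrArg (fun M => (krylov A v)ᵀ.adjugate * M) hG
      simp only [← Matrix.mul_assoc, adjugate_mul, Matrix.smul_mul, Matrix.one_mul,
        det_transpose] at h2
      rw [Matrix.one_mul]
      exact (smul_right_injective _ hdet h2).symm
    exact eq_of_mul_eq_mul_of_det_ne_zero hdet h1
  · apply eq_of_mul_eq_mul_of_det_ne_zero hdet
    ext i j
    have h1 := congrFun (hp (X * X ^ (j : ℕ))) i
    have h2 := hp (X ^ (j : ℕ))
    simp only [map_mul, map_pow, aeval_X, ← mulVec_mulVec] at h1 h2
    rw [← h2] at h1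
    change ((Q * A) *ᵥ (A ^ (j : ℕ) *ᵥ v)) i = ((A' * Q) *ᵥ (A ^ (j : ℕ) *ᵥ v)) i
    rw [← mulVec_mulVec, ← mulVec_mulVec]
    exact h1

/-- In each row the integers `x` satisfy `∑ x = ∑ x^2 = 1`, while `x^2 - x ≥ 0`; so every entry is 0
or 1. -/
theorem exists_equiv_of_orthogonal {Q : Matrix (Fin n) (Fin n) ℤ} (hQ : Qᵀ * Q = 1)
    (h1 : Q *ᵥ 1 = 1) :
    ∃ σ : Fin n ≃ Fin n, ∀ i j, Q i j = if j = σ i then 1 else 0 := by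
  have hQ' : Q * Qᵀ = 1 := mul_eq_one_comm.mp hQ
  have hsum (i : Fin n) : ∑ j, Q i j = 1 := by
    have := congrFun h1 i
    simpa [mulVec, dotProduct] using this
  have hsq (i : Fin n) : ∑ j, Q i j * Q i j = 1 := by
    have := congrFun (congrFun hQ' i) i
    simpa [Matrix.mul_apply] using this
  have hle (x : ℤ) : 0 ≤ x * x - x := by
    rcases le_or_gt x 0 with h | h <;> nlinarith
  have h01 (i j : Fin n) : Q i j = 0 ∨ Q i j = 1 := by
    have h2 : ∑ j, (Q i j * Q i j - Q i j) = 0 := by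
      rw [Finset.sum_sub_distrib, hsum, hsq, sub_self]
    have h3 := (Finset.sum_eq_zero_iff_of_nonneg fun j _ => hle (Q i j)).mp h2 j
      (Finset.mem_univ j)
    have h4 : Q i j * (Q i j - 1) = 0 := by linarith
    rcases mul_eq_zero.mp h4 with h | h
    · exact Or.inl h
    · exact Or.inr (by linarith)
  have hex (i : Fin n) : ∃ j, Q i j = 1 := by
    by_contra! hno
    have : ∑ j, Q i j = 0 := Finset.sum_eq_zero fun j _ => (h01 i j).resolve_right (hno j)
    rw [hsum] at this
    exact one_ne_zero this
  choose σ hσ using hex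
  have hQσ (i j : Fin n) : Q i j = if j = σ i then 1 else 0 := by
    split_ifs with h
    · rw [h, hσ]
    · have h2 := hsum i
      rw [← Finset.add_sum_erase _ _ (Finset.mem_univ (σ i)), hσ] at h2
      have h3 : ∑ j ∈ Finset.univ.erase (σ i), Q i j = 0 := by linarith
      refine (Finset.sum_eq_zero_iff_of_nonneg fun j _ => ?_).mp h3 j (by simp [h])
      rcases h01 i j with h | h <;> simp [h]
  have hinj : Function.Injective σ := by
    intro i j hij
    by_contra hne
    have h2 := congrFun (congrFun hQ' i) j
    simp [Matrix.mul_apply, hQσ, hij, hne] at h2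
  exact ⟨Equiv.ofBijective σ (Finite.injective_iff_bijective.mp hinj), hQσ⟩

end Rigidity

/-! ### Translation between graphs and matrices. -/

section Graph

variable {n : ℕ}

open Classical in
theorem nonempty_iso_of_orthogonal {G H : SimpleGraph (Fin n)} {Q : Matrix (Fin n) (Fin n) ℤ}
    (hQ : Qᵀ * Q = 1) (h1 : Q *ᵥ 1 = 1) (hA : Q * G.adjMatrix ℤ = H.adjMatrix ℤ * Q) :
    Nonempty (H ≃g G) := by
  obtain ⟨σ, hσ⟩ := exists_equiv_of_orthogonal hQ h1
  refine ⟨⟨σ, fun {i j} => ?_⟩⟩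
  have h2 := congrFun (congrFun hA i) (σ j)
  simp only [Matrix.mul_apply, hσ, ite_mul, one_mul, zero_mul, Finset.sum_ite_eq',
    Finset.mem_univ, if_true] at h2
  simp only [mul_ite, mul_one, mul_zero, σ.injective.eq_iff, Finset.sum_ite_eq,
    Finset.mem_univ, if_true, SimpleGraph.adjMatrix_apply] at h2
  by_cases hG : G.Adj (σ i) (σ j) <;> by_cases hH : H.Adj i j <;> simp_all

open Classical in
theorem charpoly_eq_of_spec_eq {G H : SimpleGraph (Fin n)} (h : spec G = spec H) :
    (G.adjMatrix ℤ).charpoly = (H.adjMatrix ℤ).charpoly := by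
  have hmap (G : SimpleGraph (Fin n)) :
      (G.adjMatrix ℤ).charpoly.map (Int.castRingHom ℂ) = (G.adjMatrix ℂ).charpoly := by
    rw [← charpoly_map]
    congr 1
    ext i j
    simp [SimpleGraph.adjMatrix_apply, apply_ite]
  apply map_injective (Int.castRingHom ℂ) Int.cast_injective
  rw [hmap, hmap, (IsAlgClosed.splits (G.adjMatrix ℂ).charpoly).eq_prod_roots_of_monic
      (charpoly_monic _),
    (IsAlgClosed.splits (H.adjMatrix ℂ).charpoly).eq_prod_roots_of_monic (charpoly_monic _)]
  congr 2

theorem adjMatrix_compl_eq (G : SimpleGraph (Fin n)) [DecidableRel G.Adj]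
    [DecidableRel Gᶜ.Adj] : Gᶜ.adjMatrix ℤ = of 1 - 1 - G.adjMatrix ℤ := by
  ext i j
  rcases eq_or_ne i j with rfl | hij
  · simp
  · by_cases h : G.Adj i j <;> simp [h, hij]

open Classical in
theorem exists_adjMatrix_mulVec_one_eq {G : SimpleGraph (Fin n)} (hG : IsEulerianGraph G) :
    ∃ f : Fin n → ℤ, G.adjMatrix ℤ *ᵥ 1 = (2 : ℤ) • f := by
  choose f hf using hG.2
  refine ⟨fun i => f i, ?_⟩
  ext i
  have : (G.adjMatrix ℤ *ᵥ 1) i = G.degree i := by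
    simp [mulVec, dotProduct, SimpleGraph.adjMatrix_apply,
      SimpleGraph.card_neighborFinset_eq_degree,
      ← SimpleGraph.neighborFinset_eq_filter]
  rw [this]
  have h2 := hf i
  simp only [Pi.smul_apply, smul_eq_mul]
  rw [two_mul, ← Nat.cast_add]
  exact congrArg _ h2

end Graph

end EulerianDGS

open EulerianDGS Matrix in
open Classical in
theorem theorem1p2 (n : ℕ) (G : SimpleGraph (Fin n)) (hG : EulerianDGS.IsEulerianGraph G) :
    (2 : ℤ) ^ ((3 * n - 3) / 2) ∣ (EulerianDGS.walkMatrix G).det ∧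
    ∀ q : ℤ, (EulerianDGS.walkMatrix G).det = 2 ^ ((3 * n - 3) / 2) * q →
      Odd q → Squarefree q → EulerianDGS.IsDGSAmongEulerian G := by
  have hW : walkMatrix G = krylov (G.adjMatrix ℤ) 1 := rfl
  have hd (G : SimpleGraph (Fin n)) (i : Fin n) : G.adjMatrix ℤ i i = 0 := by simp
  obtain ⟨f, hf⟩ := exists_adjMatrix_mulVec_one_eq hG
  rw [hW]
  refine ⟨two_pow_dvd_det_krylov G.isSymm_adjMatrix (hd G) hf, ?_⟩
  rintro q hq hodd hsq H hH ⟨hs, hsc⟩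
  obtain ⟨f', hf'⟩ := exists_adjMatrix_mulVec_one_eq hH
  have hφ := charpoly_eq_of_spec_eq hs
  have hφc := charpoly_eq_of_spec_eq hsc
  rw [adjMatrix_compl_eq, adjMatrix_compl_eq] at hφc
  have hm := moment_one_eq_of_charpoly_eq hφ hφc
  obtain ⟨Q, hQ⟩ := exists_mul_krylov_eq G.isSymm_adjMatrix H.isSymm_adjMatrix (hd G) (hd H) hf hf'
    hφ hm hq hodd hsq
  have hdet : (krylov (G.adjMatrix ℤ) 1).det ≠ 0 := by
    rw [hq]
    exact mul_ne_zero (pow_ne_zero _ two_ne_zero) hsq.ne_zero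
  obtain ⟨hQ1, hQ2, hQ3⟩ := orthogonal_of_mul_krylov G.isSymm_adjMatrix H.isSymm_adjMatrix hφ hm
    hdet hQ
  exact nonempty_iso_of_orthogonal hQ1 hQ2 hQ3
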